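/- Let $k$ be a field, let $A=k[x_1,\dots,x_r]$, $B=k[y_1,\dots,y_s]$ and $R=k[x_1,\dots,x_r,y_1,\dots,y_s]$ be polynomial rings with the standard grading, let $I\subset A$ be a nonzero proper homogeneous ideal, and let $J\subset B$ be a nonzero ideal generated by linear forms (homogeneous polynomials of degree $1$). Write $I+J$ for the sum of the extensions $IR+JR$ in $R$. For a finitely generated graded module $M$ over a standard graded polynomial ring with maximal homogeneous ideal $\mathfrak m$, let $\operatorname{depth} M=\min\{i : H^i_{\mathfrak m}(M)\neq 0\}$ and $\operatorname{reg} M=\max_{i\ge 0}\{a^i(M)+i\}$, where $a^i(M)=\max\{t : [H^i_{\mathfrak m}(M)]_t\neq 0\}$ (and $-\infty$ if $H^i_{\mathfrak m}(M)=0$). Then for every $n\ge 1$: (i) $\displaystyle \operatorname{depth} R/(I+J)^n=\min_{1\le i\le n}\operatorname{depth} A/I^i+\dim B/J$; (ii) $\displaystyle \operatorname{reg} R/(I+J)^n=\max_{1\le i\le n}\{\operatorname{reg} A/I^i-i\}+n$. -/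

import Mathlib

noncomputable section

namespace GradedLocalCohomology

/-! ### The Čech complex of a finite family of elements with coefficients in a module -/

section Cech

variable {A : Type*} [CommRing A] {ι : Type*}

/-- The multiplicative set generated by the elements `x j`, `j ∈ F`. -/
def cechMonoid (x : ι → A) (F : Finset ι) : Submonoid A :=
  Submonoid.closure (x '' (F : Set ι))

theorem cechMonoid_mono (x : ι → A) {F G : Finset ι} (h : F ⊆ G) :
    cechMonoid x F ≤ cechMonoid x G :=
  Submonoid.closure_mono (Set.image_mono (Finset.coe_subset.mpr h))

variable [LinearOrder ι] (x : ι → A) (M : Type*) [AddCommGroup M] [Module A M]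

/-- The localization of `M` that inverts `x j` for all `j ∈ F`. -/
abbrev CechTerm (F : Finset ι) : Type _ :=
  LocalizedModule (cechMonoid x F) M

/-- The canonical map between localizations, for `F ⊆ G`: it sends `m / s` to `m / s`. -/
def cechRestrict {F G : Finset ι} (h : F ⊆ G) : CechTerm x M F →ₗ[A] CechTerm x M G :=
  IsLocalizedModule.liftOfLE (cechMonoid x F) (cechMonoid x G) (cechMonoid_mono x h)
    (LocalizedModule.mkLinearMap (cechMonoid x F) M)
    (LocalizedModule.mkLinearMap (cechMonoid x G) M)

/-- The Čech cochains of degree `i`: the product of the localizations of `M` at the products of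
`i` of the elements (so that the cochains of degree `0` are `M` itself). -/
abbrev CechCochain (i : ℕ) : Type _ :=
  ∀ F : {F : Finset ι // F.card = i}, CechTerm x M F.1

/-- The Čech differential
`(d c)(G) = ∑_{j ∈ G} (-1) ^ #{l ∈ G | l < j} • c (G \ {j})`. -/
def cechD (i : ℕ) : CechCochain x M i →ₗ[A] CechCochain x M (i + 1) :=
  LinearMap.pi fun G => ∑ j : {j // j ∈ G.1},
    ((-1 : A) ^ (G.1.filter (fun l => l < j.1)).card) •
      (cechRestrict x M (Finset.erase_subset j.1 G.1) ∘ₗ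
        LinearMap.proj (R := A) (φ := fun F : {F : Finset ι // F.card = i} => CechTerm x M F.1)
          ⟨G.1.erase j.1, by rw [Finset.card_erase_of_mem j.2, G.2, Nat.add_sub_cancel]⟩)

/-- The Čech cocycles of degree `i`. -/
abbrev cechCocycles (i : ℕ) : Submodule A (CechCochain x M i) :=
  LinearMap.ker (cechD x M i)

/-- The Čech coboundaries of degree `i`. -/
def cechCoboundaries : (i : ℕ) → Submodule A (CechCochain x M i)
  | 0 => ⊥
  | i + 1 => LinearMap.range (cechD x M i)

/-- The `i`-th Čech cohomology module: cocycles modulo coboundaries. -/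
abbrev CechCohomology (i : ℕ) : Type _ :=
  cechCocycles x M i ⧸ (cechCoboundaries x M i).comap (cechCocycles x M i).subtype

variable {M}

/-- If `A` and `M` are graded by `𝒜` and `ℳ` and the `x j` are homogeneous, the part of degree `t`
of a localization of `M` consists of the fractions `m / s` with `s` homogeneous of some degree `e`
and `m` homogeneous of degree `t + e`. -/
def cechTermDegree (𝒜 : ℤ → AddSubgroup A) (ℳ : ℤ → AddSubgroup M) (F : Finset ι) (t : ℤ) :
    AddSubgroup (CechTerm x M F) :=
  AddSubgroup.closure {z | ∃ (e : ℤ) (m : M) (s : cechMonoid x F),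
    (s : A) ∈ 𝒜 e ∧ m ∈ ℳ (t + e) ∧ z = LocalizedModule.mk m s}

/-- The cochains of internal degree `t`: all components are homogeneous of degree `t`. -/
def cechCochainDegree (𝒜 : ℤ → AddSubgroup A) (ℳ : ℤ → AddSubgroup M) (i : ℕ) (t : ℤ) :
    AddSubgroup (CechCochain x M i) :=
  AddSubgroup.pi Set.univ fun F => cechTermDegree x 𝒜 ℳ F.1 t

/-- The part of internal degree `t` of the `i`-th Čech cohomology module: the classes of the
cocycles that are homogeneous of degree `t`. -/
def cechCohomologyDegree (𝒜 : ℤ → AddSubgroup A) (ℳ : ℤ → AddSubgroup M) (i : ℕ) (t : ℤ) :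
    AddSubgroup (CechCohomology x M i) :=
  ((cechCochainDegree x 𝒜 ℳ i t).comap (cechCocycles x M i).subtype.toAddMonoidHom).map
    (Submodule.mkQ ((cechCoboundaries x M i).comap
      (cechCocycles x M i).subtype)).toAddMonoidHom

end Cech

/-! ### Local cohomology, depth and regularity over a standard graded polynomial ring -/

section Polynomial

variable {σ k : Type*} [LinearOrder σ] [Field k]

attribute [local instance] MvPolynomial.gradedAlgebra in
/-- An ideal of a polynomial ring is homogeneous with respect to the standard grading. -/
def IsHomogeneousIdeal {σ k : Type*} [Field k] (I : Ideal (MvPolynomial σ k)) : Prop :=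
  I.IsHomogeneous (MvPolynomial.homogeneousSubmodule σ k)

/-- The homogeneous polynomials of degree `t`, for an integer `t` (only `0` if `t < 0`). -/
def polyDegree (σ k : Type*) [Field k] (t : ℤ) : AddSubgroup (MvPolynomial σ k) :=
  if 0 ≤ t then (MvPolynomial.homogeneousSubmodule σ k t.toNat).toAddSubgroup else ⊥

/-- The grading of the residue class ring of a homogeneous ideal: the residue classes of the
homogeneous polynomials of degree `t`. -/
def quotDegree (Q : Ideal (MvPolynomial σ k)) (t : ℤ) : AddSubgroup (MvPolynomial σ k ⧸ Q) :=
  (polyDegree σ k t).map (Ideal.Quotient.mk Q).toAddMonoidHom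

/-- The local cohomology module `H^i_𝔪(M)` of a module `M` over the polynomial ring in the
variables `σ`, with support in the ideal `𝔪` generated by the variables, as the cohomology of the
Čech complex of the variables. -/
abbrev LocalCohomology (σ k : Type*) [LinearOrder σ] [Field k] (M : Type*) [AddCommGroup M]
    [Module (MvPolynomial σ k) M] (i : ℕ) : Type _ :=
  CechCohomology (fun j : σ => (MvPolynomial.X j : MvPolynomial σ k)) M i

/-- The homogeneous part `[H^i_𝔪(M)]_t` of degree `t` of the local cohomology module of a graded
module `M`, whose part of degree `t` is `ℳ t`. -/
def localCohomologyDegree {M : Type*} [AddCommGroup M] [Module (MvPolynomial σ k) M]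
    (ℳ : ℤ → AddSubgroup M) (i : ℕ) (t : ℤ) : AddSubgroup (LocalCohomology σ k M i) :=
  cechCohomologyDegree (fun j : σ => (MvPolynomial.X j : MvPolynomial σ k))
    (polyDegree σ k) ℳ i t

/-- The depth of `M`: the least `i` with `H^i_𝔪(M) ≠ 0` (`⊤` if there is none, as for `M = 0`). -/
def depth (σ k : Type*) [LinearOrder σ] [Field k] (M : Type*) [AddCommGroup M]
    [Module (MvPolynomial σ k) M] : ℕ∞ :=
  ⨅ (i : ℕ) (_ : Nontrivial (LocalCohomology σ k M i)), (i : ℕ∞)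

/-- The invariant `a^i(M)`: the greatest `t` with `[H^i_𝔪(M)]_t ≠ 0`, and `⊥ = -∞` if there is
none. -/
def aInvariant {M : Type*} [AddCommGroup M] [Module (MvPolynomial σ k) M]
    (ℳ : ℤ → AddSubgroup M) (i : ℕ) : EReal :=
  ⨆ (t : ℤ) (_ : localCohomologyDegree (σ := σ) (k := k) ℳ i t ≠ ⊥), (((t : ℤ) : ℝ) : EReal)

/-- The Castelnuovo–Mumford regularity of a graded module: the maximum of `a^i(M) + i`. -/
def reg {M : Type*} [AddCommGroup M] [Module (MvPolynomial σ k) M]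
    (ℳ : ℤ → AddSubgroup M) : EReal :=
  ⨆ i : ℕ, aInvariant (σ := σ) (k := k) ℳ i + (((i : ℕ) : ℝ) : EReal)

/-- The depth of the residue class ring of an ideal. -/
def depthQuot (Q : Ideal (MvPolynomial σ k)) : ℕ∞ :=
  depth σ k (MvPolynomial σ k ⧸ Q)

/-- The Castelnuovo–Mumford regularity of the residue class ring of a homogeneous ideal. -/
def regQuot (Q : Ideal (MvPolynomial σ k)) : EReal :=
  reg (σ := σ) (k := k) (quotDegree Q)

/-- For ideals `I` of `k[x_1, …, x_r]` and `J` of `k[y_1, …, y_s]`, the sum of the extensions of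
`I` and `J` in `k[x_1, …, x_r, y_1, …, y_s]`. -/
def sumIdeal {r s : ℕ} (I : Ideal (MvPolynomial (Fin r) k)) (J : Ideal (MvPolynomial (Fin s) k)) :
    Ideal (MvPolynomial (Fin (r + s)) k) :=
  I.map (MvPolynomial.rename (R := k) (Fin.castAdd s)) +
    J.map (MvPolynomial.rename (R := k) (Fin.natAdd r))

end Polynomial

end GradedLocalCohomology

end

/-!
After a linear change of coordinates `J` is generated by some of the variables, say `z₁, …, z_p`,
and the remaining ones are `w₁, …, w_d`, where `d = dim B/J`. Since
`(I + J) ^ n = ∑ I ^ (n - e) J ^ e`, the ring `R/(I + J) ^ n` is, over `A[w₁, …, w_d]`, the direct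
sum of the modules `(A/I ^ (n - |α|))[w₁, …, w_d] z ^ α` with `|α| < n`; all the powers of `I` up to
the `n`-th occur because `p ≥ 1`. The `z`'s act nilpotently, so
they do not influence local cohomology; and each `w` replaces the local cohomology by its tensor
product with `w⁻¹ k[w⁻¹]` in the next cohomological degree, which raises the depth by one and keeps
the regularity.

The `y`-variables are treated one at a time, starting with the last one. By Gaussian elimination
(`IsLinearIdeal.eq_extLast_or`), either `J` is extended from the ring without the last variable, or
it has besides such an extended ideal one more generator `y_s - ℓ`, with `ℓ` not involving `y_s`.
Both cases are statements about an arbitrary homogeneous ideal `Q` of `k[x₁, …, x_m]`: the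
cohomology of `k[x₁, …, x_{m+1}]/Q` (`not_vanishesAt_extLast_iff`) and that of
`k[x₁, …, x_{m+1}]/(Q + (x_{m+1} - ℓ)) ^ n` (`vanishesAt_add_lastSub_pow_iff`) are determined degree
by degree. In the second case `x_{m+1}` itself is not nilpotent, but it lies in the radical of the
ideal generated by the other variables and the annihilator of the module, so it may be left out of
the Čech complex (`cechVanishes_iff_of_mem_radical`).

To work without localizations, a Čech cochain is represented by its numerators over a common power
`N` of the denominators, so that the Čech complex becomes the direct limit over `N` of the
Koszul complexes of the `N`-th powers of the variables. `CechVanishes` is the vanishing of its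
cohomology in a given degree in these terms, and `localCohomologyDegree_eq_bot_iff` and
`nontrivial_localCohomology_iff` make the connection. Depth and regularity depend only on the set of
pairs `(i, t)` with `[H^i]_t ≠ 0`, so comparing the vanishing degree by degree suffices.
-/

namespace GradedLocalCohomology

/-! ### The Koszul complexes of the powers of a family of elements -/

section Koszul

variable {ι A M : Type*} [LinearOrder ι] [CommRing A] [AddCommGroup M] [Module A M]

/-- The sign with which the component at `G \ {j}` enters the component at `G` of the Čech
differential. -/
def cechSign (G : Finset ι) (j : ι) : ℤ :=
  (-1) ^ (G.filter (fun l => l < j)).card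

theorem cechSign_mul_self (G : Finset ι) (j : ι) : cechSign G j * cechSign G j = 1 := by
  rw [cechSign, ← pow_add, ← two_mul, pow_mul]
  simp

theorem cechSign_erase_self (G : Finset ι) (j : ι) : cechSign (G.erase j) j = cechSign G j := by
  unfold cechSign
  congr 2
  ext l
  simp only [Finset.mem_filter, Finset.mem_erase]
  exact ⟨fun h => ⟨h.1.2, h.2⟩, fun h => ⟨⟨h.2.ne, h.1⟩, h.2⟩⟩

theorem cechSign_insert_self (G : Finset ι) (j : ι) : cechSign (insert j G) j = cechSign G j := by
  unfold cechSign
  rw [Finset.filter_insert, if_neg (lt_irrefl j)]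

/-- The sign rule behind the contraction of the Koszul complex: of two indices, exactly one
precedes the other. -/
theorem cechSign_insert_mul {G : Finset ι} {j l : ι} (hj : j ∉ G) (hl : l ∈ G) :
    cechSign G l * cechSign (G.erase l) j = -(cechSign G j * cechSign (insert j G) l) := by
  have hne : j ≠ l := fun h => hj (h ▸ hl)
  unfold cechSign
  rw [Finset.filter_insert, Finset.filter_erase]
  rcases lt_or_gt_of_ne hne with h | h
  · rw [if_pos h, Finset.card_insert_of_notMem (fun h' => hj (Finset.mem_filter.1 h').1),
      Finset.erase_eq_of_notMem (a := l) (s := G.filter (fun a => a < j))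
        (fun h' => absurd (Finset.mem_filter.1 h').2 h.not_gt)]
    ring
  · rw [if_neg h.not_gt]
    have hmem : l ∈ G.filter (fun a => a < j) := Finset.mem_filter.2 ⟨hl, h⟩
    rw [← Finset.card_erase_add_one hmem]
    ring

/-- The differential of the Koszul cochain complex of the powers `x j ^ N` on `M`. A function
`c : Finset ι → M` is regarded as a Čech cochain in all degrees at once, "of level `N`": it stands
for the cochain with components `c F / (∏ j ∈ F, x j) ^ N`, and `koszulD x N` is the Čech
differential on these numerators. -/
def koszulD (x : ι → A) (N : ℕ) : (Finset ι → M) →ₗ[A] (Finset ι → M) :=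
  LinearMap.pi fun G => ∑ j ∈ G, cechSign G j • x j ^ N • LinearMap.proj (G.erase j)

theorem koszulD_apply (x : ι → A) (N : ℕ) (c : Finset ι → M) (G : Finset ι) :
    koszulD x N c G = ∑ j ∈ G, cechSign G j • x j ^ N • c (G.erase j) := by
  simp [koszulD, LinearMap.sum_apply]

theorem koszulD_map {A' M' : Type*} [CommRing A'] [AddCommGroup M'] [Module A' M']
    {x : ι → A} {x' : ι → A'} (φ : M →+ M') (hφ : ∀ j m, φ (x j • m) = x' j • φ m)
    (N : ℕ) (c : Finset ι → M) (G : Finset ι) :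
    φ (koszulD x N c G) = koszulD x' N (fun F => φ (c F)) G := by
  have hpow : ∀ (j : ι) (n : ℕ) (m : M), φ (x j ^ n • m) = x' j ^ n • φ m := by
    intro j n
    induction n with
    | zero => simp
    | succ n ih => intro m; rw [pow_succ, mul_smul, ih, hφ, pow_succ, mul_smul]
  rw [koszulD_apply, koszulD_apply, map_sum]
  exact Finset.sum_congr rfl fun j _ => by rw [map_zsmul, hpow]

theorem map_prod_pow_smul {A' M' : Type*} [CommRing A'] [AddCommGroup M'] [Module A' M']
    {x : ι → A} {x' : ι → A'} (φ : M →+ M') (hφ : ∀ j m, φ (x j • m) = x' j • φ m)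
    (F : Finset ι) (e : ℕ) (m : M) :
    φ ((∏ j ∈ F, x j) ^ e • m) = (∏ j ∈ F, x' j) ^ e • φ m := by
  have hprod : ∀ m : M, φ ((∏ j ∈ F, x j) • m) = (∏ j ∈ F, x' j) • φ m := by
    induction F using Finset.induction_on with
    | empty => simp
    | insert a F ha ih =>
      intro m
      rw [Finset.prod_insert ha, Finset.prod_insert ha, mul_smul, hφ, ih, mul_smul]
  induction e generalizing m with
  | zero => simp
  | succ e ih => rw [pow_succ, mul_smul, ih, hprod, pow_succ, mul_smul]

/-- Passing from level `N` to level `N + e` expands the fractions by `(∏ j ∈ F, x j) ^ e`; this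
commutes with the differentials. -/
theorem koszulD_expand (x : ι → A) (N e : ℕ) (c : Finset ι → M) (G : Finset ι) :
    koszulD x (N + e) (fun F => (∏ j ∈ F, x j) ^ e • c F) G =
      (∏ j ∈ G, x j) ^ e • koszulD x N c G := by
  rw [koszulD_apply, koszulD_apply, Finset.smul_sum]
  refine Finset.sum_congr rfl fun j hj => ?_
  rw [smul_comm _ (cechSign G j)]
  congr 1
  rw [← Finset.mul_prod_erase G x hj, smul_smul, smul_smul]
  congr 1
  ring

/-- Multiplication by `x j ^ N` is null-homotopic on the Koszul complex of the `N`-th powers. -/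
theorem exists_koszulD_eq_pow_smul (x : ι → A) {N i : ℕ} {c : Finset ι → M}
    (hc : ∀ G, G.card = i + 1 → koszulD x N c G = 0) (j : ι) :
    ∃ b : Finset ι → M, ∀ F, F.card = i → x j ^ N • c F = koszulD x N b F := by
  -- the contracting homotopy evaluates at the sets with `j` inserted
  refine ⟨fun F => if j ∈ F then 0 else cechSign F j • c (insert j F), fun F hF => ?_⟩
  rw [koszulD_apply]
  by_cases hj : j ∈ F
  · rw [Finset.sum_eq_single_of_mem j hj]
    · rw [if_neg (Finset.notMem_erase j F), Finset.insert_erase hj, cechSign_erase_self,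
        smul_comm (x j ^ N), smul_smul, cechSign_mul_self, one_smul]
    · intro l _ hlj
      rw [if_pos (Finset.mem_erase.2 ⟨hlj.symm, hj⟩), smul_zero, smul_zero]
  · have h := hc (insert j F) (by rw [Finset.card_insert_of_notMem hj, hF])
    rw [koszulD_apply, Finset.sum_insert hj, Finset.erase_insert hj, cechSign_insert_self] at h
    have h2 : x j ^ N • c F = -(cechSign F j •
        ∑ l ∈ F, cechSign (insert j F) l • x l ^ N • c ((insert j F).erase l)) := by
      have := congrArg (fun m => cechSign F j • m) h
      simp only [smul_add, smul_zero, smul_smul, cechSign_mul_self, one_smul] at this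
      rw [eq_neg_iff_add_eq_zero]
      simpa only [smul_smul] using this
    rw [h2, Finset.smul_sum, ← Finset.sum_neg_distrib]
    refine Finset.sum_congr rfl fun l hl => ?_
    have hne : j ≠ l := fun h => hj (h ▸ hl)
    rw [if_neg (fun h' => hj (Finset.mem_of_mem_erase h')),
      Finset.erase_insert_of_ne hne, smul_comm (x l ^ N), smul_smul, smul_smul,
      cechSign_insert_mul hj hl, neg_smul]

/-- Every class in the Koszul cohomology of the `N`-th powers is killed by a power of any element
of the radical of the ideal generated by the `x j` and the annihilator of the module. -/
theorem exists_koszulD_eq_pow_smul_of_mem_radical (x : ι → A) {N i : ℕ} {c : Finset ι → M}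
    (hc : ∀ G, G.card = i + 1 → koszulD x N c G = 0) {y : A}
    (hy : y ∈ (Ideal.span (Set.range x) ⊔ Module.annihilator A M).radical) :
    ∃ (e : ℕ) (b : Finset ι → M), ∀ F, F.card = i → y ^ e • c F = koszulD x N b F := by
  -- the annihilator of the class of `c` is an ideal
  let 𝔠 : Ideal A :=
    { carrier := {a | ∃ b : Finset ι → M, ∀ F, F.card = i → a • c F = koszulD x N b F}
      add_mem' := by
        rintro a a' ⟨b, hb⟩ ⟨b', hb'⟩
        exact ⟨b + b', fun F hF => by
          rw [add_smul, hb F hF, hb' F hF, map_add, Pi.add_apply]⟩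
      zero_mem' := ⟨0, fun F _ => by rw [zero_smul, map_zero, Pi.zero_apply]⟩
      smul_mem' := by
        rintro a a' ⟨b, hb⟩
        exact ⟨a • b, fun F hF => by
          rw [smul_eq_mul, mul_smul, hb F hF, map_smul, Pi.smul_apply]⟩ }
  have hle : Ideal.span (Set.range x) ⊔ Module.annihilator A M ≤ 𝔠.radical := by
    refine sup_le (Ideal.span_le.2 ?_) ?_
    · rintro _ ⟨j, rfl⟩
      exact ⟨N, exists_koszulD_eq_pow_smul x hc j⟩
    · intro a ha
      refine Ideal.le_radical ⟨0, fun F _ => ?_⟩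
      rw [Module.mem_annihilator.1 ha, map_zero, Pi.zero_apply]
  obtain ⟨e, he⟩ := Ideal.radical_le_radical_iff.2 hle hy
  exact ⟨e, he⟩

/-- The vanishing of the part of degree `t` of the `i`-th Čech cohomology of a graded module,
expressed with numerators: each cocycle of level `N` and degree `t` becomes a coboundary at some
higher level. (A cochain of level `N` has degree `t` if its numerators at the sets of `i` elements
have degree `t + N i`.) The values of `c` and `b` at sets of other cardinalities are irrelevant, and
`b` is not required to be homogeneous, which makes no difference for graded modules. -/
def CechVanishes (x : ι → A) (ℳ : ℤ → AddSubgroup M) (i : ℕ) (t : ℤ) : Prop :=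
  ∀ (N : ℕ) (c : Finset ι → M), (∀ F, F.card = i → c F ∈ ℳ (t + N * i)) →
    (∀ G, G.card = i + 1 → koszulD x N c G = 0) →
    ∃ (e : ℕ) (b : Finset ι → M), ∀ F, F.card = i →
      (∏ j ∈ F, x j) ^ e • c F = koszulD x (N + e) b F

/-- A cochain of level `N` that is a coboundary at level `N + e` is one at all higher levels. -/
theorem exists_expand_of_le {x : ι → A} {N i e e' : ℕ} (h : e ≤ e') {c b : Finset ι → M}
    (hb : ∀ F, F.card = i → (∏ j ∈ F, x j) ^ e • c F = koszulD x (N + e) b F) :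
    ∃ b' : Finset ι → M, ∀ F, F.card = i →
      (∏ j ∈ F, x j) ^ e' • c F = koszulD x (N + e') b' F := by
  obtain ⟨f, rfl⟩ := Nat.exists_eq_add_of_le h
  refine ⟨fun F => (∏ j ∈ F, x j) ^ f • b F, fun F hF => ?_⟩
  rw [← add_assoc, koszulD_expand, ← hb F hF, smul_smul, ← pow_add, add_comm f]

theorem exists_expand_sum {x : ι → A} {N i : ℕ} {κ : Type*} (T : Finset κ)
    {c : κ → Finset ι → M}
    (h : ∀ a ∈ T, ∃ (e : ℕ) (b : Finset ι → M), ∀ F, F.card = i →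
      (∏ j ∈ F, x j) ^ e • c a F = koszulD x (N + e) b F) :
    ∃ (e : ℕ) (b : Finset ι → M), ∀ F, F.card = i →
      (∏ j ∈ F, x j) ^ e • ∑ a ∈ T, c a F = koszulD x (N + e) b F := by
  classical
  induction T using Finset.induction_on with
  | empty => exact ⟨0, 0, fun F _ => by simp⟩
  | insert a T ha ih =>
    obtain ⟨e₁, b₁, h₁⟩ := h a (Finset.mem_insert_self _ _)
    obtain ⟨e₂, b₂, h₂⟩ := ih fun a' ha' => h a' (Finset.mem_insert_of_mem ha')
    obtain ⟨b₁', h₁'⟩ := exists_expand_of_le (le_max_left e₁ e₂) h₁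
    obtain ⟨b₂', h₂'⟩ := exists_expand_of_le (le_max_right e₁ e₂) h₂
    refine ⟨max e₁ e₂, b₁' + b₂', fun F hF => ?_⟩
    rw [Finset.sum_insert ha, smul_add, h₁' F hF, h₂' F hF, map_add, Pi.add_apply]

section Transport

variable {A' M' : Type*} [CommRing A'] [AddCommGroup M'] [Module A' M']
  {x : ι → A} {x' : ι → A'} {ℳ : ℤ → AddSubgroup M} {ℳ' : ℤ → AddSubgroup M'}

theorem map_cochain_expand (φ : M →+ M') (hφ : ∀ j m, φ (x j • m) = x' j • φ m) {N i : ℕ}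
    {c : Finset ι → M}
    (h : ∃ (e : ℕ) (b : Finset ι → M), ∀ F, F.card = i →
      (∏ j ∈ F, x j) ^ e • c F = koszulD x (N + e) b F) :
    ∃ (e : ℕ) (b : Finset ι → M'), ∀ F, F.card = i →
      (∏ j ∈ F, x' j) ^ e • φ (c F) = koszulD x' (N + e) b F := by
  obtain ⟨e, b, h⟩ := h
  refine ⟨e, fun F => φ (b F), fun F hF => ?_⟩
  rw [← koszulD_map φ hφ, ← h F hF, map_prod_pow_smul φ hφ]

/-- Vanishing passes to graded retracts, up to the shift of degrees by `a`. -/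
theorem CechVanishes.of_retract (φ : M →+ M') (hφ : ∀ j m, φ (x j • m) = x' j • φ m)
    (ψ : M' →+ M) (hψ : ∀ j m, ψ (x' j • m) = x j • ψ m) (hφψ : ∀ m, φ (ψ m) = m) (a : ℤ)
    (hdeg : ∀ u, ∀ m ∈ ℳ' u, ψ m ∈ ℳ (u + a)) {i : ℕ} {t : ℤ}
    (h : CechVanishes x ℳ i (t + a)) : CechVanishes x' ℳ' i t := by
  intro N c hc hd
  have := map_cochain_expand φ hφ (h N (fun F => ψ (c F)) ?_ ?_)
  · simpa only [hφψ] using this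
  · intro F hF
    have := hdeg _ _ (hc F hF)
    rwa [add_right_comm] at this
  · intro G hG
    rw [← koszulD_map ψ hψ, hd G hG, map_zero]

end Transport

/-- If each element of `M` is the sum of its images under endomorphisms `ψ a ∘ φ a` that factor
through graded modules `M' a` (with degrees shifted by `s a`), then vanishing for the `M' a` implies
vanishing for `M`. -/
theorem CechVanishes.of_sum {κ : Type*} (T : Finset κ) {A' : Type*} [CommRing A']
    {M' : κ → Type*} [∀ a, AddCommGroup (M' a)] [∀ a, Module A' (M' a)]
    {x : ι → A} {x' : ι → A'} {ℳ : ℤ → AddSubgroup M} {ℳ' : ∀ a, ℤ → AddSubgroup (M' a)}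
    (φ : ∀ a, M →+ M' a) (hφ : ∀ a j m, φ a (x j • m) = x' j • φ a m)
    (ψ : ∀ a, M' a →+ M) (hψ : ∀ a j m, ψ a (x' j • m) = x j • ψ a m)
    (hsum : ∀ m, ∑ a ∈ T, ψ a (φ a m) = m) (s : κ → ℤ)
    (hdeg : ∀ a ∈ T, ∀ u, ∀ m ∈ ℳ (u + s a), φ a m ∈ ℳ' a u) {i : ℕ} {t : ℤ}
    (h : ∀ a ∈ T, CechVanishes x' (ℳ' a) i (t - s a)) : CechVanishes x ℳ i t := by
  intro N c hc hd
  have := exists_expand_sum (x := x) (N := N) (i := i) T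
    (c := fun a F => ψ a (φ a (c F))) fun a ha =>
      map_cochain_expand (ψ a) (hψ a) (h a ha N (fun F => φ a (c F)) ?_ ?_)
  · simpa only [hsum] using this
  · intro F hF
    refine hdeg a ha _ _ ?_
    convert hc F hF using 2
    ring
  · intro G hG
    rw [← koszulD_map (φ a) (hφ a), hd G hG, map_zero]

end Koszul

/-! ### The last of several elements -/

section LastElement

variable {m : ℕ}

/-- A finite set of indices, regarded as a set of indices in the larger range. -/
abbrev emb (F : Finset (Fin m)) : Finset (Fin (m + 1)) :=
  F.map Fin.castSuccEmb

/-- A finite set of indices together with the last index of the larger range. -/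
abbrev embLast (F : Finset (Fin m)) : Finset (Fin (m + 1)) :=
  insert (Fin.last m) (emb F)

theorem last_notMem_emb (F : Finset (Fin m)) : Fin.last m ∉ emb F := by
  intro h
  obtain ⟨j, _, hj⟩ := Finset.mem_map.1 h
  exact (Fin.castSucc_lt_last j).ne hj

theorem card_embLast (F : Finset (Fin m)) : (embLast F).card = F.card + 1 := by
  rw [embLast, Finset.card_insert_of_notMem (last_notMem_emb F), Finset.card_map]

/-- The indices of a set other than the last one of the range. -/
def unemb (G : Finset (Fin (m + 1))) : Finset (Fin m) :=
  Finset.univ.filter fun j => j.castSucc ∈ G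

theorem unemb_emb (F : Finset (Fin m)) : unemb (emb F) = F := by
  ext j
  simp [unemb]

theorem unemb_embLast (F : Finset (Fin m)) : unemb (embLast F) = F := by
  ext j
  simp [unemb]

theorem eq_emb_or_embLast (G : Finset (Fin (m + 1))) :
    G = emb (unemb G) ∨ G = embLast (unemb G) := by
  by_cases h : Fin.last m ∈ G
  · right
    ext j
    induction j using Fin.lastCases with
    | last => simp [h]
    | cast j => simp [unemb, (Fin.castSucc_lt_last j).ne]
  · left
    ext j
    induction j using Fin.lastCases with
    | last => simp [h]
    | cast j => simp [unemb]

/-- The cochain with given components at the sets without and with the last index. -/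
def joinCochain {M : Type*} (u v : Finset (Fin m) → M) (G : Finset (Fin (m + 1))) : M :=
  if Fin.last m ∈ G then v (unemb G) else u (unemb G)

@[simp]
theorem joinCochain_emb {M : Type*} (u v : Finset (Fin m) → M) (F : Finset (Fin m)) :
    joinCochain u v (emb F) = u F := by
  rw [joinCochain, if_neg (last_notMem_emb F), unemb_emb]

@[simp]
theorem joinCochain_embLast {M : Type*} (u v : Finset (Fin m) → M) (F : Finset (Fin m)) :
    joinCochain u v (embLast F) = v F := by
  rw [joinCochain, if_pos (Finset.mem_insert_self _ _), unemb_embLast]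

theorem forall_card_eq_iff {p : Finset (Fin (m + 1)) → Prop} {i : ℕ} :
    (∀ G, G.card = i → p G) ↔
      (∀ F : Finset (Fin m), F.card = i → p (emb F)) ∧
        ∀ F : Finset (Fin m), F.card + 1 = i → p (embLast F) := by
  constructor
  · exact fun h => ⟨fun F hF => h _ (by rw [Finset.card_map, hF]),
      fun F hF => h _ (by rw [card_embLast, hF])⟩
  · rintro ⟨h₁, h₂⟩ G hG
    rcases eq_emb_or_embLast G with h | h
    · rw [h]
      exact h₁ _ (by rw [← hG]; conv_rhs => rw [h, Finset.card_map])
    · rw [h]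
      exact h₂ _ (by rw [← card_embLast, ← h, hG])

variable {A M : Type*} [CommRing A] [AddCommGroup M] [Module A M] (x : Fin (m + 1) → A)

theorem koszulD_emb (N : ℕ) (c : Finset (Fin (m + 1)) → M) (G : Finset (Fin m)) :
    koszulD x N c (emb G) = koszulD (fun j => x j.castSucc) N (fun F => c (emb F)) G := by
  rw [koszulD_apply, koszulD_apply, Finset.sum_map]
  refine Finset.sum_congr rfl fun j _ => ?_
  have h₁ : cechSign (emb G) (Fin.castSuccEmb j) = cechSign G j := by
    unfold cechSign
    rw [Finset.filter_map, Finset.card_map]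
    rfl
  rw [h₁, emb, ← Finset.map_erase]
  rfl

theorem koszulD_embLast (N : ℕ) (c : Finset (Fin (m + 1)) → M) (G : Finset (Fin m)) :
    koszulD x N c (embLast G) =
      koszulD (fun j => x j.castSucc) N (fun F => c (embLast F)) G +
        (-1 : ℤ) ^ G.card • x (Fin.last m) ^ N • c (emb G) := by
  rw [koszulD_apply, koszulD_apply, Finset.sum_insert (last_notMem_emb G), add_comm,
    Finset.sum_map]
  congr 1
  · refine Finset.sum_congr rfl fun j _ => ?_
    have h₁ : cechSign (embLast G) (Fin.castSuccEmb j) = cechSign G j := by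
      unfold cechSign
      rw [embLast, Finset.filter_insert, if_neg (not_lt.2 (Fin.le_last _)),
        Finset.filter_map, Finset.card_map]
      rfl
    rw [h₁, embLast, Finset.erase_insert_of_ne (b := Fin.castSuccEmb j)
      (Fin.castSucc_lt_last j).ne', emb, ← Finset.map_erase]
    rfl
  · rw [Finset.erase_insert (last_notMem_emb G)]
    congr 1
    rw [cechSign_insert_self, cechSign, Finset.filter_true_of_mem, Finset.card_map]
    intro l hl
    obtain ⟨j, _, rfl⟩ := Finset.mem_map.1 hl
    exact Fin.castSucc_lt_last j

theorem prod_emb (F : Finset (Fin m)) : ∏ j ∈ emb F, x j = ∏ j ∈ F, x j.castSucc := by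
  rw [Finset.prod_map]
  rfl

theorem prod_embLast (F : Finset (Fin m)) :
    ∏ j ∈ embLast F, x j = x (Fin.last m) * ∏ j ∈ F, x j.castSucc := by
  rw [Finset.prod_insert (last_notMem_emb F), prod_emb]

end LastElement

/-! ### Leaving out an element of the radical -/

/-- The additive maps `p t` are the projections onto the homogeneous parts `ℳ t` of a module on
which the elements `x j` act with degree `1`. -/
structure IsGradedBy {ι A M : Type*} [CommRing A] [AddCommGroup M] [Module A M] (x : ι → A)
    (ℳ : ℤ → AddSubgroup M) (p : ℤ → M →+ M) : Prop where
  mem : ∀ t m, p t m ∈ ℳ t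
  eq_self : ∀ t, ∀ m ∈ ℳ t, p t m = m
  smul : ∀ t j m, p (t + 1) (x j • m) = x j • p t m
  exists_sum : ∀ m, ∃ T : Finset ℤ, ∀ T', T ⊆ T' → ∑ t ∈ T', p t m = m

namespace IsGradedBy

variable {ι A M : Type*} [CommRing A] [AddCommGroup M] [Module A M] {x : ι → A}
  {ℳ : ℤ → AddSubgroup M} {p : ℤ → M →+ M} (h : IsGradedBy x ℳ p)
include h

theorem pow_smul (t : ℤ) (j : ι) (e : ℕ) (m : M) :
    p (t + e) (x j ^ e • m) = x j ^ e • p t m := by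
  induction e with
  | zero => simp
  | succ e ih =>
    rw [pow_succ', mul_smul, mul_smul, Nat.cast_succ, ← add_assoc, h.smul, ih]

theorem pow_smul_mem {t : ℤ} (j : ι) (e : ℕ) {m : M} (hm : m ∈ ℳ t) :
    x j ^ e • m ∈ ℳ (t + e) := by
  rw [← h.eq_self t m hm, ← h.pow_smul]
  exact h.mem _ _

theorem prod_smul_mem {t : ℤ} (F : Finset ι) {m : M} (hm : m ∈ ℳ t) :
    (∏ j ∈ F, x j) • m ∈ ℳ (t + F.card) := by
  classical
  induction F using Finset.induction_on with
  | empty => simpa using hm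
  | insert a F ha ih =>
    rw [Finset.prod_insert ha, mul_smul, Finset.card_insert_of_notMem ha, Nat.cast_succ,
      ← add_assoc, ← pow_one (x a)]
    exact_mod_cast h.pow_smul_mem a 1 ih

theorem prod_pow_smul_mem {t : ℤ} (F : Finset ι) (e : ℕ) {m : M} (hm : m ∈ ℳ t) :
    (∏ j ∈ F, x j) ^ e • m ∈ ℳ (t + e * F.card) := by
  induction e with
  | zero => simpa using hm
  | succ e ih =>
    rw [pow_succ', mul_smul]
    convert h.prod_smul_mem F ih using 2
    push_cast
    ring

theorem koszulD_proj [LinearOrder ι] (t : ℤ) (N : ℕ) (c : Finset ι → M) (G : Finset ι) :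
    p (t + N) (koszulD x N c G) = koszulD x N (fun F => p t (c F)) G := by
  rw [koszulD_apply, koszulD_apply, map_sum]
  exact Finset.sum_congr rfl fun j _ => by rw [map_zsmul, h.pow_smul]

theorem comp {ι' : Type*} (f : ι' → ι) : IsGradedBy (fun j => x (f j)) ℳ p :=
  ⟨h.mem, h.eq_self, fun t j => h.smul t (f j), h.exists_sum⟩

end IsGradedBy

section Radical

variable {m : ℕ} {A M : Type*} [CommRing A] [AddCommGroup M] [Module A M]
  {x : Fin (m + 1) → A} {ℳ : ℤ → AddSubgroup M} {p : ℤ → M →+ M}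

/-- The Čech cohomology of `M` does not change when the last element is left out, provided it lies
in the radical of the ideal generated by the other ones and the annihilator of `M`. -/
theorem cechVanishes_iff_of_mem_radical (h : IsGradedBy x ℳ p)
    (hy : x (Fin.last m) ∈
      (Ideal.span (Set.range fun j : Fin m => x j.castSucc) ⊔ Module.annihilator A M).radical)
    (i : ℕ) (t : ℤ) :
    CechVanishes x ℳ i t ↔ CechVanishes (fun j : Fin m => x j.castSucc) ℳ i t := by
  have hx := h.comp Fin.castSucc
  constructor
  · intro hV N u hu hdu
    obtain ⟨e, w₀, hw₀⟩ := exists_koszulD_eq_pow_smul_of_mem_radical _ hdu hy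
    -- make the primitive of `y ^ e • u` homogeneous
    let w : Finset (Fin m) → M := fun F => p (t + N * i + e - N) (w₀ F)
    have hw : ∀ F : Finset (Fin m), F.card = i →
        x (Fin.last m) ^ e • u F = koszulD (fun j : Fin m => x j.castSucc) N w F := by
      intro F hF
      rw [← hx.koszulD_proj, ← hw₀ F hF, sub_add_cancel, h.pow_smul, h.eq_self _ _ (hu F hF)]
    -- `κ` completes the expansion of `u` to level `N + e` to a cocycle for all the elements
    let κ : Finset (Fin m) → M :=
      (-(-1) ^ i * x (Fin.last m) ^ N : A) • fun F => (∏ j ∈ F, x j.castSucc) ^ e • w F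
    have key := hV (N + e)
      (joinCochain (fun F => (∏ j ∈ F, x j.castSucc) ^ e • u F) κ) ?_ ?_
    · obtain ⟨e', b, hb⟩ := key
      refine ⟨e + e', fun F => b (emb F), fun F hF => ?_⟩
      have := hb (emb F) (by rw [Finset.card_map, hF])
      rw [koszulD_emb, joinCochain_emb, prod_emb, smul_smul, ← pow_add] at this
      rw [← add_assoc, ← this, add_comm e]
    · refine forall_card_eq_iff.2 ⟨fun F hF => ?_, fun F hF => ?_⟩
      · rw [joinCochain_emb]
        convert hx.prod_pow_smul_mem F e (hu F hF) using 2
        rw [hF]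
        push_cast
        ring
      · rw [joinCochain_embLast]
        have hmem := h.pow_smul_mem (Fin.last m) N
          (hx.prod_pow_smul_mem F e (h.mem (t + N * i + e - N) (w₀ F)))
        have hdeg : t + N * i + e - N + e * F.card + N = t + ((N + e : ℕ) : ℤ) * i := by
          rw [← hF]
          push_cast
          ring
        rw [hdeg] at hmem
        have hκ : κ F = ((-(-1) ^ i : ℤ)) •
            x (Fin.last m) ^ N • (∏ j ∈ F, x j.castSucc) ^ e • w F := by
          rw [← Int.cast_smul_eq_zsmul A, smul_smul]
          simp [κ]
        rw [hκ]
        exact AddSubgroup.zsmul_mem _ hmem _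
    · refine forall_card_eq_iff.2 ⟨fun G hG => ?_, fun G hG => ?_⟩
      · rw [koszulD_emb]
        simp only [joinCochain_emb]
        rw [koszulD_expand, hdu G hG, smul_zero]
      · rw [koszulD_embLast, joinCochain_emb]
        simp only [joinCochain_embLast]
        rw [show (fun F => κ F) = κ from rfl, map_smul, Pi.smul_apply, koszulD_expand,
          ← hw G (by omega), ← Int.cast_smul_eq_zsmul A, smul_smul, smul_smul, smul_smul,
          smul_smul, ← add_smul]
        convert zero_smul A _
        have : G.card = i := by omega
        rw [this]
        push_cast
        ring
  · intro hV N c hc hdc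
    obtain ⟨hdu, hdv⟩ := forall_card_eq_iff.1 hdc
    simp only [koszulD_emb] at hdu
    simp only [koszulD_embLast] at hdv
    obtain ⟨e, b, hb⟩ := hV N (fun F => c (emb F)) (forall_card_eq_iff.1 hc).1 hdu
    rcases i with _ | i
    · refine ⟨e, joinCochain b 0, forall_card_eq_iff.2 ⟨fun F hF => ?_, fun F hF => by omega⟩⟩
      rw [prod_emb, koszulD_emb, hb F hF]
      simp only [joinCochain_emb]
    -- subtracting the coboundary of `b` leaves a cocycle supported on the sets with the last index
    · let v : Finset (Fin m) → M := x (Fin.last m) ^ e •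
        ((fun F => (∏ j ∈ F, x j.castSucc) ^ e • c (embLast F)) -
          ((-1) ^ i * x (Fin.last m) ^ N : A) • b)
      have key := exists_koszulD_eq_pow_smul_of_mem_radical
        (fun j : Fin m => x j.castSucc) (N := N + e) (i := i) (c := v) (fun G hG => ?_) hy
      · obtain ⟨f, w, hw⟩ := key
        refine ⟨e + f, joinCochain (fun F => (∏ j ∈ F, x j.castSucc) ^ f • b F)
          (fun F => (∏ j ∈ F, x j.castSucc) ^ f • w F),
          forall_card_eq_iff.2 ⟨fun F hF => ?_, fun F hF => ?_⟩⟩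
        · rw [prod_emb, koszulD_emb, ← add_assoc]
          simp only [joinCochain_emb]
          rw [koszulD_expand, ← hb F hF, smul_smul, ← pow_add, add_comm f]
        · rw [prod_embLast, koszulD_embLast, joinCochain_emb, ← add_assoc]
          simp only [joinCochain_embLast]
          rw [koszulD_expand, ← hw F (by omega)]
          have hF' : F.card = i := by omega
          simp only [v, Pi.smul_apply, Pi.sub_apply, smul_sub, smul_smul, hF']
          rw [← Int.cast_smul_eq_zsmul A, smul_smul]
          push_cast
          module
      · simp only [v, map_smul, map_sub, Pi.smul_apply, Pi.sub_apply]
        rw [koszulD_expand, ← hb G hG]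
        have := hdv G (by omega)
        rw [← Int.cast_smul_eq_zsmul A, hG] at this
        rw [eq_neg_of_add_eq_zero_left this]
        simp only [smul_neg, smul_smul, smul_sub]
        rw [neg_sub_left, ← add_smul, neg_eq_zero]
        convert zero_smul A _
        push_cast
        ring

end Radical

/-! ### Polynomial extensions -/

section PolynomialExtension

/-- The module `P` is the polynomial extension of the graded module `M` by the last element
`y = x (Fin.last m)`: `φ e` takes the coefficient of `y ^ e`, and `ψ e` multiplies by `y ^ e`. -/
structure IsPolynomialExtension {m : ℕ} {A P : Type*} [CommRing A] [AddCommGroup P] [Module A P]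
    {A' M : Type*} [CommRing A'] [AddCommGroup M] [Module A' M]
    (x : Fin (m + 1) → A) (𝒬 : ℤ → AddSubgroup P) (x' : Fin m → A') (ℳ : ℤ → AddSubgroup M)
    (φ : ℕ → P →+ M) (ψ : ℕ → M →+ P) : Prop where
  coeff_smul : ∀ e j q, φ e (x j.castSucc • q) = x' j • φ e q
  monomial_smul : ∀ e j n, ψ e (x' j • n) = x j.castSucc • ψ e n
  coeff_succ_smul : ∀ e q, φ (e + 1) (x (Fin.last m) • q) = φ e q
  coeff_zero_smul : ∀ q, φ 0 (x (Fin.last m) • q) = 0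
  monomial_succ : ∀ e n, ψ (e + 1) n = x (Fin.last m) • ψ e n
  coeff_monomial : ∀ e e' n, φ e (ψ e' n) = if e = e' then n else 0
  exists_sum : ∀ q, ∃ K, ∑ e ∈ Finset.range K, ψ e (φ e q) = q
  coeff_mem : ∀ (e : ℕ) (t : ℤ), ∀ q ∈ 𝒬 t, φ e q ∈ ℳ (t - e)
  monomial_mem : ∀ (e : ℕ) (t : ℤ), ∀ n ∈ ℳ t, ψ e n ∈ 𝒬 (t + e)

namespace IsPolynomialExtension

variable {m : ℕ} {A P : Type*} [CommRing A] [AddCommGroup P] [Module A P]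
  {A' M : Type*} [CommRing A'] [AddCommGroup M] [Module A' M]
  {x : Fin (m + 1) → A} {𝒬 : ℤ → AddSubgroup P} {x' : Fin m → A'} {ℳ : ℤ → AddSubgroup M}
  {φ : ℕ → P →+ M} {ψ : ℕ → M →+ P} (h : IsPolynomialExtension x 𝒬 x' ℳ φ ψ)
include h

theorem coeff_pow_smul (e N : ℕ) (q : P) : φ (e + N) (x (Fin.last m) ^ N • q) = φ e q := by
  induction N with
  | zero => simp
  | succ N ih => rw [pow_succ', mul_smul, ← add_assoc, h.coeff_succ_smul, ih]

theorem coeff_pow_smul_of_lt {e N : ℕ} (he : e < N) (q : P) :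
    φ e (x (Fin.last m) ^ N • q) = 0 := by
  obtain ⟨f, rfl⟩ := Nat.exists_eq_add_of_lt he
  rw [show e + f + 1 = f + 1 + e by omega, pow_add, mul_comm, mul_smul]
  have := h.coeff_pow_smul 0 e (x (Fin.last m) ^ (f + 1) • q)
  rw [zero_add] at this
  rw [this, pow_succ', mul_smul, h.coeff_zero_smul]

theorem monomial_add (e N : ℕ) (n : M) : ψ (e + N) n = x (Fin.last m) ^ N • ψ e n := by
  induction N with
  | zero => simp
  | succ N ih => rw [pow_succ', mul_smul, ← ih, ← add_assoc, h.monomial_succ]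

theorem eq_zero {q : P} (hq : ∀ e, φ e q = 0) : q = 0 := by
  obtain ⟨K, hK⟩ := h.exists_sum q
  rw [← hK]
  exact Finset.sum_eq_zero fun e _ => by rw [hq, map_zero]

theorem ext {q q' : P} (hq : ∀ e, φ e q = φ e q') : q = q' :=
  sub_eq_zero.1 (h.eq_zero fun e => by rw [map_sub, hq, sub_self])

theorem coeff_sum (K e : ℕ) (n : ℕ → M) :
    φ e (∑ f ∈ Finset.range K, ψ f (n f)) = if e < K then n e else 0 := by
  simp only [map_sum, h.coeff_monomial, Finset.sum_ite_eq, Finset.mem_range]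

/-- Division with remainder by `y ^ N`. -/
theorem exists_eq_add_pow_smul (N : ℕ) (q : P) : ∃ w : P, (∀ e, φ e w = φ (e + N) q) ∧
    q = ∑ e ∈ Finset.range N, ψ e (φ e q) + x (Fin.last m) ^ N • w := by
  obtain ⟨K, hK⟩ := h.exists_sum q
  have hw : ∀ e, φ e (∑ f ∈ Finset.range K, ψ f (φ (f + N) q)) = φ (e + N) q := by
    intro e
    rw [h.coeff_sum]
    split_ifs with he
    · rfl
    · conv_rhs => rw [← hK]
      rw [h.coeff_sum, if_neg (by omega)]
  refine ⟨_, hw, h.ext fun e => ?_⟩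
  rw [map_add, h.coeff_sum]
  split_ifs with he
  · rw [h.coeff_pow_smul_of_lt he, add_zero]
  · obtain ⟨f, rfl⟩ := Nat.exists_eq_add_of_le' (not_lt.1 he)
    rw [h.coeff_pow_smul, hw, zero_add]

theorem cechVanishes_zero (t : ℤ) : CechVanishes x 𝒬 0 t := by
  intro N c _ hdc
  refine ⟨0, 0, fun F hF => ?_⟩
  have h₁ := hdc (embLast ∅) (by rw [card_embLast, Finset.card_empty])
  rw [koszulD_embLast, koszulD_apply, Finset.sum_empty, zero_add, Finset.card_empty, pow_zero,
    one_smul] at h₁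
  have h₂ : c (emb ∅) = 0 := h.eq_zero fun e => by
    rw [← h.coeff_pow_smul e N, h₁, map_zero]
  rw [Finset.card_eq_zero.1 hF]
  simpa using h₂

/-- The cohomology of `M[y]` is that of `M` tensored with `y⁻¹ k[y⁻¹]`, with the cohomological
degree raised by one. -/
theorem cechVanishes_succ_iff {p : ℤ → M →+ M} (hM : IsGradedBy x' ℳ p) (i : ℕ) (t : ℤ) :
    CechVanishes x 𝒬 (i + 1) t ↔ ∀ e : ℕ, 1 ≤ e → CechVanishes x' ℳ i (t + e) := by
  constructor
  · intro hV e he N c hc hdc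
    -- the class of `c` times `y ^ (-e)`, written over `y ^ (N + e)`
    let v : Finset (Fin m) → P := fun F => ψ N ((∏ j ∈ F, x' j) ^ e • c F)
    have key := hV (N + e) (joinCochain 0 v) ?_ ?_
    · obtain ⟨f, b, hb⟩ := key
      refine ⟨e + f, fun F => φ (N + f) (b (embLast F)), fun F hF => ?_⟩
      have h₁ := hb (embLast F) (by rw [card_embLast, hF])
      rw [joinCochain_embLast, prod_embLast, koszulD_embLast, mul_pow, mul_smul,
        ← map_prod_pow_smul (x := x') (x' := fun j => x j.castSucc) (ψ N) (h.monomial_smul N),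
        ← h.monomial_add] at h₁
      -- the coefficients of `y ^ (N + f)` do not see multiples of `y ^ (N + e + f)`, as `1 ≤ e`
      have h₂ := congrArg (φ (N + f)) h₁
      rw [h.coeff_monomial, if_pos rfl, map_add, map_zsmul, h.coeff_pow_smul_of_lt (by omega),
        smul_zero, add_zero,
        koszulD_map (x' := x') (φ (N + f)) (h.coeff_smul (N + f)), smul_smul, ← pow_add,
        add_comm f, add_assoc] at h₂
      exact h₂
    · refine forall_card_eq_iff.2 ⟨fun F _ => ?_, fun F hF => ?_⟩
      · rw [joinCochain_emb]
        exact AddSubgroup.zero_mem _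
      · rw [joinCochain_embLast]
        convert h.monomial_mem N _ _ (hM.prod_pow_smul_mem F e (hc F (by omega))) using 2
        rw [show F.card = i by omega]
        push_cast
        ring
    · refine forall_card_eq_iff.2 ⟨fun G _ => ?_, fun G hG => ?_⟩
      · rw [koszulD_emb]
        simp only [joinCochain_emb]
        rw [koszulD_apply]
        simp
      · rw [koszulD_embLast, joinCochain_emb]
        simp only [joinCochain_embLast, v]
        rw [← koszulD_map (x := x') (ψ N) (h.monomial_smul N), koszulD_expand,
          hdc G (by omega)]
        simp
  · intro hV N c hc hdc
    obtain ⟨-, hdv⟩ := forall_card_eq_iff.1 hdc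
    obtain ⟨-, hcv⟩ := forall_card_eq_iff.1 hc
    simp only [koszulD_embLast] at hdv
    -- `c (embLast F) / y ^ N` splits into `w F` and a part with negative powers of `y` only
    choose w hw hcw using fun F : Finset (Fin m) => h.exists_eq_add_pow_smul N (c (embLast F))
    have hdv' : ∀ (e : ℕ) (G : Finset (Fin m)), G.card = i + 1 →
        koszulD x' N (fun F => φ e (c (embLast F))) G =
          -((-1 : ℤ) ^ (i + 1) • φ e (x (Fin.last m) ^ N • c (emb G))) := by
      intro e G hG
      have := congrArg (φ e) (hdv G (by omega))
      rw [map_add, map_zsmul, map_zero,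
        koszulD_map (x' := x') (φ e) (h.coeff_smul e), hG] at this
      exact eq_neg_of_add_eq_zero_left this
    -- the components without the last index come from the coboundary of `w`
    have hu : ∀ G : Finset (Fin m), G.card = i + 1 →
        c (emb G) = (-1 : ℤ) ^ i • koszulD (fun j => x j.castSucc) N w G := by
      intro G hG
      refine h.ext fun e => ?_
      rw [map_zsmul, koszulD_map (x' := x') (φ e) (h.coeff_smul e)]
      simp only [hw]
      rw [hdv' _ G hG, h.coeff_pow_smul, smul_neg, smul_smul, ← pow_add,
        show i + (i + 1) = 2 * i + 1 by ring, pow_succ, pow_mul]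
      simp
    -- the coefficients of the negative powers are cocycles of `M`
    obtain ⟨f, b, hb⟩ := exists_expand_sum (x := fun j : Fin m => x j.castSucc) (N := N) (i := i)
      (Finset.range N) (c := fun e F => ψ e (φ e (c (embLast F)))) fun e he =>
        map_cochain_expand (ψ e) (h.monomial_smul e)
          (hV (N - e) (by have := Finset.mem_range.1 he; omega) N (fun F => φ e (c (embLast F)))
            (fun F hF => by
              convert h.coeff_mem e _ _ (hcv F (by omega)) using 2
              have := Finset.mem_range.1 he
              push_cast [this.le]
              ring)
            (fun G hG => by
              rw [hdv' e G hG, h.coeff_pow_smul_of_lt (Finset.mem_range.1 he), smul_zero,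
                neg_zero]))
    refine ⟨f, joinCochain (((-1) ^ i : A) • fun F => (∏ j ∈ F, x j.castSucc) ^ f • w F)
      (x (Fin.last m) ^ f • b), forall_card_eq_iff.2 ⟨fun F hF => ?_, fun F hF => ?_⟩⟩
    · rw [prod_emb, koszulD_emb]
      simp only [joinCochain_emb]
      rw [show (fun F => (((-1) ^ i : A) • fun F => (∏ j ∈ F, x j.castSucc) ^ f • w F) F) =
        ((-1) ^ i : A) • fun F => (∏ j ∈ F, x j.castSucc) ^ f • w F from rfl, map_smul,
        Pi.smul_apply, koszulD_expand, hu F hF, ← Int.cast_smul_eq_zsmul A]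
      push_cast
      rw [smul_comm]
    · rw [prod_embLast, koszulD_embLast, joinCochain_emb]
      simp only [joinCochain_embLast]
      rw [show (fun F => (x (Fin.last m) ^ f • b) F) = x (Fin.last m) ^ f • b from rfl, map_smul,
        Pi.smul_apply, ← hb F (by omega), Pi.smul_apply, ← Int.cast_smul_eq_zsmul A]
      have hF' : F.card = i := by omega
      conv_lhs => rw [hcw F]
      simp only [smul_smul, smul_add, hF', mul_pow]
      congr 1
      congr 1
      push_cast
      have : ((-1) ^ i * (-1) ^ i : A) = 1 := by rw [← mul_pow]; simp
      linear_combination (-(x (Fin.last m) ^ f * (∏ j ∈ F, x j.castSucc) ^ f *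
        x (Fin.last m) ^ N)) * this

end IsPolynomialExtension

end PolynomialExtension

/-! ### Čech cochains as families of fractions -/

section Fractions

variable {ι A M : Type*} [CommRing A] [AddCommGroup M] [Module A M] (x : ι → A)

theorem prod_pow_mem_cechMonoid (F : Finset ι) (N : ℕ) : (∏ j ∈ F, x j) ^ N ∈ cechMonoid x F :=
  pow_mem (prod_mem fun _ hj => Submonoid.subset_closure (Set.mem_image_of_mem x hj)) N

theorem exists_mul_eq_prod_pow {F : Finset ι} (s : cechMonoid x F) :
    ∃ (N : ℕ) (s' : A), (s : A) * s' = (∏ j ∈ F, x j) ^ N := by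
  classical
  obtain ⟨s, hs⟩ := s
  induction hs using Submonoid.closure_induction with
  | mem a ha =>
    obtain ⟨j, hj, rfl⟩ := ha
    exact ⟨1, ∏ l ∈ F.erase j, x l, by rw [pow_one]; exact Finset.mul_prod_erase F x hj⟩
  | one => exact ⟨0, 1, by simp⟩
  | mul a b _ _ iha ihb =>
    obtain ⟨N, s, h⟩ := iha
    obtain ⟨N', s', h'⟩ := ihb
    refine ⟨N + N', s * s', ?_⟩
    rw [pow_add, ← h, ← h']
    ring

/-- The fraction with numerator `n` and denominator `(∏ j ∈ F, x j) ^ N`. -/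
def cechFrac (F : Finset ι) (N : ℕ) : M →ₗ[A] CechTerm x M F where
  toFun n := LocalizedModule.mk n ⟨_, prod_pow_mem_cechMonoid x F N⟩
  map_add' n n' := by
    rw [LocalizedModule.mk_add_mk, ← smul_add, LocalizedModule.mk_cancel_common_left]
  map_smul' a n := (LocalizedModule.smul'_mk a n _).symm

theorem cechFrac_eq_iff {F : Finset ι} {N N' : ℕ} {n n' : M} :
    cechFrac x F N n = cechFrac x F N' n' ↔
      ∃ f, (∏ j ∈ F, x j) ^ (f + N') • n = (∏ j ∈ F, x j) ^ (f + N) • n' := by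
  refine LocalizedModule.mk_eq.trans ⟨?_, ?_⟩
  · rintro ⟨u, hu⟩
    obtain ⟨f, s', hs'⟩ := exists_mul_eq_prod_pow x u
    refine ⟨f, ?_⟩
    have := congrArg (fun n => s' • n) hu
    simp only [Submonoid.smul_def, smul_smul, ← mul_assoc] at this
    rwa [mul_comm s', hs', ← pow_add, ← pow_add] at this
  · rintro ⟨f, hf⟩
    refine ⟨⟨_, prod_pow_mem_cechMonoid x F f⟩, ?_⟩
    simpa only [Submonoid.smul_def, smul_smul, ← pow_add] using hf

theorem cechFrac_expand (F : Finset ι) (N e : ℕ) (n : M) :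
    cechFrac x F (N + e) ((∏ j ∈ F, x j) ^ e • n) = cechFrac x F N n := by
  rw [cechFrac_eq_iff]
  refine ⟨0, ?_⟩
  rw [smul_smul, ← pow_add]
  congr 2
  omega

theorem exists_cechFrac_eq {F : Finset ι} (z : CechTerm x M F) :
    ∃ (N : ℕ) (n : M), z = cechFrac x F N n := by
  induction z using LocalizedModule.induction_on with
  | h n s =>
    obtain ⟨N, s', h⟩ := exists_mul_eq_prod_pow x s
    refine ⟨N, s' • n, LocalizedModule.mk_eq.2 ⟨1, ?_⟩⟩
    simp only [Submonoid.smul_def, one_smul, smul_smul]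
    rw [h]

theorem cechRestrict_cechFrac [LinearOrder ι] {G : Finset ι} {j : ι} (hj : j ∈ G) (N : ℕ) (n : M) :
    cechRestrict x M (Finset.erase_subset j G) (cechFrac x (G.erase j) N n) =
      cechFrac x G N (x j ^ N • n) := by
  unfold cechRestrict cechFrac
  simp only [LinearMap.coe_mk, AddHom.coe_mk]
  rw [IsLocalizedModule.mk_eq_mk', IsLocalizedModule.liftOfLE_mk', ← IsLocalizedModule.mk_eq_mk']
  refine LocalizedModule.mk_eq.2 ⟨1, ?_⟩
  simp only [Submonoid.smul_def, one_smul, smul_smul]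
  rw [← Finset.mul_prod_erase G x hj, mul_pow, mul_comm]

end Fractions

section Cochains

variable {ι A M : Type*} [CommRing A] [AddCommGroup M] [Module A M] (x : ι → A)

/-- The Čech cochain of degree `i` with the numerators `c` at level `N`. -/
def cechCochain (i N : ℕ) (c : Finset ι → M) : CechCochain x M i :=
  fun F => cechFrac x F.1 N (c F.1)

theorem cechCochain_congr {i N : ℕ} {c c' : Finset ι → M} (h : ∀ F, F.card = i → c F = c' F) :
    cechCochain x i N c = cechCochain x i N c' :=
  funext fun F => by rw [cechCochain, h F.1 F.2, cechCochain]

theorem cechCochain_expand (i N e : ℕ) (c : Finset ι → M) :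
    cechCochain x i (N + e) (fun F => (∏ j ∈ F, x j) ^ e • c F) = cechCochain x i N c :=
  funext fun F => cechFrac_expand x F.1 N e (c F.1)

/-- There are only finitely many sets of indices, so one level suffices for all of them. -/
theorem exists_level_of_forall [Finite ι] {i : ℕ} {p : Finset ι → ℕ → Prop}
    (hp : ∀ F N e, p F N → p F (N + e)) (h : ∀ F, F.card = i → ∃ N, p F N) :
    ∃ N, ∀ F, F.card = i → p F N := by
  have := Fintype.ofFinite ι
  choose! N hN using h
  refine ⟨Finset.univ.sup N, fun F hF => ?_⟩
  obtain ⟨e, he⟩ := Nat.exists_eq_add_of_le (Finset.le_sup (f := N) (Finset.mem_univ F))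
  rw [he]
  exact hp _ _ _ (hN F hF)

/-- The components of a Čech cochain have a common level; a property `P` of the numerators that is
stable under expansion can be retained. -/
theorem exists_cechCochain_eq [Finite ι] {i : ℕ} (P : ℕ → Finset ι → M → Prop)
    (hP : ∀ N e F n, P N F n → P (N + e) F ((∏ j ∈ F, x j) ^ e • n)) (z : CechCochain x M i)
    (hz : ∀ F, ∃ N n, P N F.1 n ∧ z F = cechFrac x F.1 N n) :
    ∃ N c, (∀ F, F.card = i → P N F (c F)) ∧ z = cechCochain x i N c := by
  classical
  obtain ⟨N, hN⟩ := exists_level_of_forall (i := i)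
    (p := fun F N => ∀ hF : F.card = i, ∃ n, P N F n ∧ z ⟨F, hF⟩ = cechFrac x F N n)
    (fun F N e h hF => by
      obtain ⟨n, hn, h⟩ := h hF
      exact ⟨_, hP N e F n hn, by rw [cechFrac_expand, h]⟩)
    (fun F hF => by
      obtain ⟨N, n, hn, h⟩ := hz ⟨F, hF⟩
      exact ⟨N, fun _ => ⟨n, hn, h⟩⟩)
  choose! c hc hc' using fun F hF => hN F hF hF
  exact ⟨N, c, hc, funext fun F => hc' F.1 F.2⟩

theorem cechCochain_eq_iff [Finite ι] {i N N' : ℕ} {c c' : Finset ι → M} :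
    cechCochain x i N c = cechCochain x i N' c' ↔ ∃ f, ∀ F, F.card = i →
      (∏ j ∈ F, x j) ^ (f + N') • c F = (∏ j ∈ F, x j) ^ (f + N) • c' F := by
  constructor
  · intro h
    refine exists_level_of_forall (fun F f e h => ?_) fun F hF =>
      (cechFrac_eq_iff x).1 (congrFun h ⟨F, hF⟩)
    rw [add_comm f, add_assoc, pow_add, mul_smul, h, smul_smul, ← pow_add, add_assoc]
  · rintro ⟨f, h⟩
    exact funext fun F => (cechFrac_eq_iff x).2 ⟨f, h F.1 F.2⟩

theorem cechCochain_eq_zero_iff [Finite ι] {i N : ℕ} {c : Finset ι → M} :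
    cechCochain x i N c = 0 ↔ ∃ f, ∀ F, F.card = i → (∏ j ∈ F, x j) ^ f • c F = 0 := by
  have h0 : (0 : CechCochain x M i) = cechCochain x i 0 0 :=
    funext fun F => ((cechFrac x F.1 0).map_zero).symm
  rw [h0, cechCochain_eq_iff]
  simp

theorem exists_eq_cechCochain [Finite ι] {i : ℕ} (z : CechCochain x M i) :
    ∃ N c, z = cechCochain x i N c := by
  obtain ⟨N, c, -, h⟩ := exists_cechCochain_eq x (fun _ _ _ => True) (fun _ _ _ _ _ => trivial) z
    fun F => by
      obtain ⟨N, n, h⟩ := exists_cechFrac_eq x (z F)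
      exact ⟨N, n, trivial, h⟩
  exact ⟨N, c, h⟩

variable [LinearOrder ι]

theorem cechD_cechCochain (i N : ℕ) (c : Finset ι → M) :
    cechD x M i (cechCochain x i N c) = cechCochain x (i + 1) N (koszulD x N c) := by
  funext G
  simp only [cechD, cechCochain, LinearMap.pi_apply, LinearMap.sum_apply, LinearMap.smul_apply,
    LinearMap.comp_apply, LinearMap.proj_apply]
  rw [koszulD_apply, map_sum, ← Finset.sum_coe_sort G.1]
  refine Finset.sum_congr rfl fun j _ => ?_
  rw [cechRestrict_cechFrac x j.2, map_zsmul, cechSign, ← Int.cast_smul_eq_zsmul A]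
  push_cast
  rfl

variable [Finite ι]

/-- In degree zero, `koszulD` vanishes at the empty set, in agreement with the coboundaries. -/
theorem mem_cechCoboundaries_iff {i : ℕ} {z : CechCochain x M i} :
    z ∈ cechCoboundaries x M i ↔ ∃ N b, z = cechCochain x i N (koszulD x N b) := by
  cases i with
  | zero =>
    have h0 : ∀ N (b : Finset ι → M), cechCochain x 0 N (koszulD x N b) = 0 := by
      intro N b
      funext F
      have : koszulD x N b F.1 = 0 := by
        rw [Finset.card_eq_zero.1 F.2, koszulD_apply, Finset.sum_empty]
      rw [cechCochain, this, map_zero]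
      rfl
    rw [cechCoboundaries, Submodule.mem_bot]
    exact ⟨fun h => ⟨0, 0, by rw [h, h0]⟩, fun ⟨N, b, h⟩ => by rw [h, h0]⟩
  | succ i =>
    rw [cechCoboundaries, LinearMap.mem_range]
    constructor
    · rintro ⟨y, rfl⟩
      obtain ⟨N, b, rfl⟩ := exists_eq_cechCochain x y
      exact ⟨N, b, cechD_cechCochain x i N b⟩
    · rintro ⟨N, b, rfl⟩
      exact ⟨_, cechD_cechCochain x i N b⟩

theorem cechCochain_mem_cechCoboundaries_iff {i N : ℕ} {c : Finset ι → M} :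
    cechCochain x i N c ∈ cechCoboundaries x M i ↔ ∃ (e : ℕ) (b : Finset ι → M), ∀ F,
      F.card = i → (∏ j ∈ F, x j) ^ e • c F = koszulD x (N + e) b F := by
  rw [mem_cechCoboundaries_iff]
  constructor
  · rintro ⟨N', b, h⟩
    obtain ⟨f, hf⟩ := (cechCochain_eq_iff x).1 h
    refine ⟨f + N', fun F => (∏ j ∈ F, x j) ^ (f + N) • b F, fun F hF => ?_⟩
    rw [hf F hF, show N + (f + N') = N' + (f + N) by omega, koszulD_expand]
  · rintro ⟨e, b, h⟩
    exact ⟨N + e, b, by rw [← cechCochain_expand x i N e c]; exact cechCochain_congr x h⟩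

/-- If the cochains in `D` are those with numerators of the degrees prescribed by `t`, then
`CechVanishes` says that the cocycles in `D` are coboundaries. This covers both the homogeneous
cochains of degree `t` and, for `ℳ = ⊤`, all cochains. -/
theorem cocycles_le_coboundaries_iff {ℳ : ℤ → AddSubgroup M} {i : ℕ} {t : ℤ}
    (hx : ∀ (N e : ℕ) (F : Finset ι) (n : M), n ∈ ℳ (t + N * F.card) →
      (∏ j ∈ F, x j) ^ e • n ∈ ℳ (t + (N + e : ℕ) * F.card))
    {D : Set (CechCochain x M i)}
    (hD : ∀ z, z ∈ D ↔ ∃ (N : ℕ) (c : Finset ι → M), (∀ F, F.card = i → c F ∈ ℳ (t + N * F.card)) ∧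
      z = cechCochain x i N c) :
    (∀ z ∈ D, cechD x M i z = 0 → z ∈ cechCoboundaries x M i) ↔ CechVanishes x ℳ i t := by
  constructor
  · intro h N c hc hd
    rw [← cechCochain_mem_cechCoboundaries_iff]
    refine h _ ((hD _).2 ⟨N, c, fun F hF => hF ▸ hc F hF, rfl⟩) ?_
    rw [cechD_cechCochain, cechCochain_eq_zero_iff]
    exact ⟨0, fun G hG => by rw [hd G hG, smul_zero]⟩
  · intro h z hz hd
    obtain ⟨N, c, hc, rfl⟩ := (hD _).1 hz
    rw [cechD_cechCochain, cechCochain_eq_zero_iff] at hd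
    obtain ⟨e, he⟩ := hd
    rw [← cechCochain_expand x i N e c, cechCochain_mem_cechCoboundaries_iff]
    refine h _ _ (fun F hF => ?_) fun G hG => ?_
    · rw [← hF]
      exact hx N e F _ (hc F hF)
    · rw [koszulD_expand, he G hG]

end Cochains

/-! ### Local cohomology over a polynomial ring -/

section LocalCohomology

open MvPolynomial

variable {σ k : Type*} [Field k] {M : Type*} [AddCommGroup M] [Module (MvPolynomial σ k) M]

theorem mem_polyDegree {t : ℤ} {f : MvPolynomial σ k} :
    f ∈ polyDegree σ k t ↔ (f = 0 ∨ ∃ d : ℕ, t = d ∧ f.IsHomogeneous d) := by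
  unfold polyDegree
  split_ifs with h
  · obtain ⟨d, rfl⟩ := Int.eq_ofNat_of_zero_le h
    rw [Int.toNat_natCast, Submodule.mem_toAddSubgroup, mem_homogeneousSubmodule]
    constructor
    · exact fun h => Or.inr ⟨d, rfl, h⟩
    · rintro (rfl | ⟨d', h, h'⟩)
      · exact isHomogeneous_zero _ _ _
      · rwa [Nat.cast_injective (R := ℤ) h]
  · rw [AddSubgroup.mem_bot]
    refine ⟨Or.inl, ?_⟩
    rintro (h' | ⟨d, h', -⟩)
    · exact h'
    · omega

theorem isHomogeneous_prod_X_pow (F : Finset σ) (N : ℕ) :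
    ((∏ j ∈ F, (X j : MvPolynomial σ k)) ^ N).IsHomogeneous (F.card * N) := by
  refine IsHomogeneous.pow ?_ N
  have := IsHomogeneous.prod F (fun j => (X j : MvPolynomial σ k)) (fun _ => 1)
    fun j _ => isHomogeneous_X k j
  simpa using this

/-- The denominators are monomials, hence homogeneous, and divide powers of the product of the
variables with homogeneous quotients. -/
theorem exists_homogeneous_mul_eq_prod_pow {F : Finset σ}
    (s : cechMonoid (fun j : σ => (X j : MvPolynomial σ k)) F) :
    ∃ (N d d' : ℕ) (s' : MvPolynomial σ k), (s : MvPolynomial σ k) * s' = (∏ j ∈ F, X j) ^ N ∧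
      (s : MvPolynomial σ k).IsHomogeneous d ∧ s'.IsHomogeneous d' ∧ d + d' = N * F.card := by
  classical
  obtain ⟨s, hs⟩ := s
  induction hs using Submonoid.closure_induction with
  | mem a ha =>
    obtain ⟨j, hj, rfl⟩ := ha
    refine ⟨1, 1, (F.erase j).card, ∏ l ∈ F.erase j, X l, ?_, isHomogeneous_X k j, ?_, ?_⟩
    · rw [pow_one]
      exact Finset.mul_prod_erase F (fun j => (X j : MvPolynomial σ k)) hj
    · simpa using isHomogeneous_prod_X_pow (k := k) (F.erase j) 1
    · have := Finset.card_erase_add_one hj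
      omega
  | one => exact ⟨0, 0, 0, 1, by simp, isHomogeneous_one _ _, isHomogeneous_one _ _, by simp⟩
  | mul a b _ _ iha ihb =>
    obtain ⟨N₁, d₁, d₁', s₁, h₁, ha, hs₁, e₁⟩ := iha
    obtain ⟨N₂, d₂, d₂', s₂, h₂, hb, hs₂, e₂⟩ := ihb
    refine ⟨N₁ + N₂, d₁ + d₂, d₁' + d₂', s₁ * s₂, ?_, ha.mul hb, hs₁.mul hs₂, ?_⟩
    · rw [pow_add, ← h₁, ← h₂]
      ring
    · rw [add_mul, ← e₁, ← e₂]
      ring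

variable {ℳ : ℤ → AddSubgroup M}

theorem mem_cechTermDegree_iff
    (hℳ : ∀ (d : ℕ) (f : MvPolynomial σ k), f.IsHomogeneous d → ∀ t, ∀ n ∈ ℳ t, f • n ∈ ℳ (t + d))
    {F : Finset σ} {t : ℤ} {z : CechTerm (fun j : σ => (X j : MvPolynomial σ k)) M F} :
    z ∈ cechTermDegree (fun j : σ => (X j : MvPolynomial σ k)) (polyDegree σ k) ℳ F t ↔
      ∃ (N : ℕ) (n : M), n ∈ ℳ (t + N * F.card) ∧
        z = cechFrac (fun j : σ => (X j : MvPolynomial σ k)) F N n := by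
  have hup : ∀ (N e : ℕ) (n : M), n ∈ ℳ (t + N * F.card) →
      (∏ j ∈ F, (X j : MvPolynomial σ k)) ^ e • n ∈ ℳ (t + (N + e : ℕ) * F.card) := by
    intro N e n hn
    convert hℳ _ _ (isHomogeneous_prod_X_pow F e) _ n hn using 2
    push_cast
    ring
  constructor
  · intro hz
    unfold cechTermDegree at hz
    induction hz using AddSubgroup.closure_induction with
    | mem z hz =>
      obtain ⟨e, n, s, hs, hn, rfl⟩ := hz
      obtain ⟨N, d, d', s', h, hsd, hs', hdd⟩ := exists_homogeneous_mul_eq_prod_pow s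
      have hs0 : (s : MvPolynomial σ k) ≠ 0 := by
        intro h0
        rw [h0, zero_mul] at h
        exact pow_ne_zero N (Finset.prod_ne_zero_iff.2 fun j _ => X_ne_zero j) h.symm
      obtain ⟨d₁, rfl, hd₁⟩ := (mem_polyDegree.1 hs).resolve_left hs0
      obtain rfl := hd₁.inj_right hsd hs0
      refine ⟨N, s' • n, ?_, LocalizedModule.mk_eq.2 ⟨1, ?_⟩⟩
      · convert hℳ d' s' hs' _ n hn using 2
        rw [add_assoc]
        exact_mod_cast congrArg (fun a : ℤ => t + a) (congrArg Nat.cast hdd.symm)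
      · simp only [Submonoid.smul_def, one_smul, smul_smul]
        rw [h]
    | zero => exact ⟨0, 0, AddSubgroup.zero_mem _, (map_zero _).symm⟩
    | add z z' _ _ hz hz' =>
      obtain ⟨N, n, hn, rfl⟩ := hz
      obtain ⟨N', n', hn', rfl⟩ := hz'
      refine ⟨N + N', _, AddSubgroup.add_mem _ (hup N N' n hn)
        (add_comm N N' ▸ hup N' N n' hn'), ?_⟩
      rw [map_add, cechFrac_expand, add_comm N, cechFrac_expand]
    | neg z _ hz =>
      obtain ⟨N, n, hn, rfl⟩ := hz
      exact ⟨N, -n, AddSubgroup.neg_mem _ hn, (map_neg _ _).symm⟩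
  · rintro ⟨N, n, hn, rfl⟩
    refine AddSubgroup.subset_closure ⟨(N * F.card : ℕ), n, ⟨_, prod_pow_mem_cechMonoid _ F N⟩,
      mem_polyDegree.2 (Or.inr ⟨_, rfl, ?_⟩), by exact_mod_cast hn, rfl⟩
    rw [mul_comm]
    exact isHomogeneous_prod_X_pow F N

theorem mem_cechCochainDegree_iff [Finite σ]
    (hℳ : ∀ (d : ℕ) (f : MvPolynomial σ k), f.IsHomogeneous d → ∀ t, ∀ n ∈ ℳ t, f • n ∈ ℳ (t + d))
    {i : ℕ} {t : ℤ} {z : CechCochain (fun j : σ => (X j : MvPolynomial σ k)) M i} :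
    z ∈ cechCochainDegree (fun j : σ => (X j : MvPolynomial σ k)) (polyDegree σ k) ℳ i t ↔
      ∃ (N : ℕ) (c : Finset σ → M), (∀ F, F.card = i → c F ∈ ℳ (t + N * F.card)) ∧
        z = cechCochain (fun j : σ => (X j : MvPolynomial σ k)) i N c := by
  rw [cechCochainDegree, AddSubgroup.mem_pi]
  constructor
  · intro h
    refine exists_cechCochain_eq _ (fun N F n => n ∈ ℳ (t + N * F.card)) ?_ z
      fun F => (mem_cechTermDegree_iff hℳ).1 (h F trivial)
    intro N e F n hn
    convert hℳ _ _ (isHomogeneous_prod_X_pow F e) _ n hn using 2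
    push_cast
    ring
  · rintro ⟨N, c, hc, rfl⟩ F -
    exact (mem_cechTermDegree_iff hℳ).2 ⟨N, c F.1, hc F.1 F.2, rfl⟩

variable [LinearOrder σ] [Finite σ]

theorem localCohomologyDegree_eq_bot_iff
    (hℳ : ∀ (d : ℕ) (f : MvPolynomial σ k), f.IsHomogeneous d → ∀ t, ∀ n ∈ ℳ t, f • n ∈ ℳ (t + d))
    (i : ℕ) (t : ℤ) :
    localCohomologyDegree (σ := σ) (k := k) ℳ i t = ⊥ ↔
      CechVanishes (fun j : σ => (X j : MvPolynomial σ k)) ℳ i t := by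
  rw [← cocycles_le_coboundaries_iff (fun j : σ => (X j : MvPolynomial σ k)) (D :=
    (cechCochainDegree (fun j : σ => (X j : MvPolynomial σ k)) (polyDegree σ k) ℳ i t : Set _))
    ?_ fun z => mem_cechCochainDegree_iff hℳ]
  · rw [localCohomologyDegree, cechCohomologyDegree, AddSubgroup.map_eq_bot_iff]
    constructor
    · intro h z hz hd
      have := h (x := ⟨z, hd⟩) hz
      exact (Submodule.Quotient.mk_eq_zero ((cechCoboundaries _ M i).comap
        (cechCocycles _ M i).subtype)).1 this
    · rintro h ⟨z, hd⟩ hz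
      exact (Submodule.Quotient.mk_eq_zero _).2 (h z hz hd)
  · intro N e F n hn
    convert hℳ _ _ (isHomogeneous_prod_X_pow F e) _ n hn using 2
    push_cast
    ring

theorem nontrivial_localCohomology_iff {p : ℤ → M →+ M}
    (h : IsGradedBy (fun j : σ => (X j : MvPolynomial σ k)) ℳ p) (i : ℕ) :
    Nontrivial (LocalCohomology σ k M i) ↔
      ∃ t, ¬ CechVanishes (fun j : σ => (X j : MvPolynomial σ k)) ℳ i t := by
  have key : Subsingleton (LocalCohomology σ k M i) ↔
      CechVanishes (fun j : σ => (X j : MvPolynomial σ k)) (M := M) (fun _ => ⊤) i 0 := by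
    rw [← cocycles_le_coboundaries_iff (fun j : σ => (X j : MvPolynomial σ k)) (D := Set.univ)
      (ℳ := fun _ => ⊤) (fun _ _ _ _ _ => trivial) fun z => ⟨fun _ => ?_, fun _ => trivial⟩]
    · rw [Submodule.Quotient.subsingleton_iff, Submodule.eq_top_iff']
      exact ⟨fun h z _ hd => h ⟨z, hd⟩, fun h z => h z.1 trivial z.2⟩
    · obtain ⟨N, c, hz⟩ := exists_eq_cechCochain _ z
      exact ⟨N, c, fun _ _ => trivial, hz⟩
  rw [← not_subsingleton_iff_nontrivial, key, ← not_forall, not_iff_not]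
  constructor
  · exact fun hV t N c _ => hV N c fun _ _ => trivial
  · -- a cocycle is the sum of its homogeneous components, which are cocycles
    intro hV N c _ hd
    obtain ⟨T, hT⟩ : ∃ T : Finset ℤ, ∀ F, ∑ u ∈ T, p u (c F) = c F := by
      have := Fintype.ofFinite σ
      classical
      choose T hT using fun F => h.exists_sum (c F)
      exact ⟨Finset.univ.biUnion T, fun F =>
        hT F _ (Finset.subset_biUnion_of_mem T (Finset.mem_univ F))⟩
    have := exists_expand_sum (x := fun j : σ => (X j : MvPolynomial σ k)) (N := N) (i := i) T
      (c := fun u F => p u (c F)) fun u _ => hV (u - N * i) N (fun F => p u (c F))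
        (fun F _ => by
          rw [sub_add_cancel]
          exact h.mem u _)
        fun G hG => by rw [← h.koszulD_proj, hd G hG, map_zero]
    simpa only [hT] using this

end LocalCohomology

open MvPolynomial

/-! ### Residue class rings of polynomial rings as graded modules -/

section Quotients

/-- The additive map between quotient rings that an additive map between rings induces. -/
def quotMap {R R' : Type*} [CommRing R] [CommRing R'] {𝔮 : Ideal R} {𝔯 : Ideal R'} (f : R →+ R')
    (hf : ∀ a ∈ 𝔮, f a ∈ 𝔯) : R ⧸ 𝔮 →+ R' ⧸ 𝔯 :=
  QuotientAddGroup.lift 𝔮.toAddSubgroup ((Ideal.Quotient.mk 𝔯).toAddMonoidHom.comp f)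
    fun a ha => Ideal.Quotient.eq_zero_iff_mem.2 (hf a ha)

theorem quotMap_mk {R R' : Type*} [CommRing R] [CommRing R'] {𝔮 : Ideal R} {𝔯 : Ideal R'}
    (f : R →+ R') (hf : ∀ a ∈ 𝔮, f a ∈ 𝔯) (a : R) :
    quotMap f hf (Ideal.Quotient.mk 𝔮 a) = Ideal.Quotient.mk 𝔯 (f a) :=
  rfl

theorem smul_mk {R : Type*} [CommRing R] (𝔮 : Ideal R) (a b : R) :
    a • Ideal.Quotient.mk 𝔮 b = Ideal.Quotient.mk 𝔮 (a * b) :=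
  rfl

variable {σ k : Type*} [Field k]

theorem mul_mem_polyDegree {t u : ℤ} {f g : MvPolynomial σ k} (hf : f ∈ polyDegree σ k t)
    (hg : g ∈ polyDegree σ k u) : f * g ∈ polyDegree σ k (t + u) := by
  rw [mem_polyDegree] at *
  rcases hf with rfl | ⟨d, rfl, hf⟩
  · simp
  · rcases hg with rfl | ⟨d', rfl, hg⟩
    · simp
    · exact Or.inr ⟨d + d', by push_cast; rfl, hf.mul hg⟩

theorem mem_polyDegree_natCast {d : ℕ} {f : MvPolynomial σ k} :
    f ∈ polyDegree σ k d ↔ f.IsHomogeneous d := by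
  rw [mem_polyDegree]
  constructor
  · rintro (rfl | ⟨d', h, hf⟩)
    · exact isHomogeneous_zero _ _ _
    · rwa [Nat.cast_injective (R := ℤ) h]
  · exact fun h => Or.inr ⟨d, rfl, h⟩

theorem mk_mem_quotDegree (Q : Ideal (MvPolynomial σ k)) {t : ℤ} {f : MvPolynomial σ k}
    (hf : f ∈ polyDegree σ k t) : Ideal.Quotient.mk Q f ∈ quotDegree Q t :=
  ⟨f, hf, rfl⟩

theorem smul_mem_quotDegree (Q : Ideal (MvPolynomial σ k)) (d : ℕ) (f : MvPolynomial σ k)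
    (hf : f.IsHomogeneous d) (t : ℤ) (n : MvPolynomial σ k ⧸ Q) (hn : n ∈ quotDegree Q t) :
    f • n ∈ quotDegree Q (t + d) := by
  obtain ⟨g, hg, rfl⟩ := hn
  rw [add_comm]
  exact mk_mem_quotDegree Q (mul_mem_polyDegree (mem_polyDegree_natCast.2 hf) hg)

theorem quotMap_mem_quotDegree {τ : Type*} {𝔮 : Ideal (MvPolynomial σ k)}
    {𝔯 : Ideal (MvPolynomial τ k)} (f : MvPolynomial σ k →+ MvPolynomial τ k)
    (hf : ∀ a ∈ 𝔮, f a ∈ 𝔯) {t u : ℤ} (h : ∀ a ∈ polyDegree σ k t, f a ∈ polyDegree τ k u)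
    {n : MvPolynomial σ k ⧸ 𝔮} (hn : n ∈ quotDegree 𝔮 t) : quotMap f hf n ∈ quotDegree 𝔯 u := by
  obtain ⟨g, hg, rfl⟩ := hn
  exact mk_mem_quotDegree 𝔯 (h g hg)

/-- The projection of a polynomial onto its homogeneous part of degree `t`. -/
noncomputable def polyProj (σ k : Type*) [Field k] (t : ℤ) : MvPolynomial σ k →+ MvPolynomial σ k :=
  if 0 ≤ t then (homogeneousComponent t.toNat).toAddMonoidHom else 0

theorem polyProj_natCast (d : ℕ) (f : MvPolynomial σ k) :
    polyProj σ k d f = homogeneousComponent d f := by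
  simp [polyProj]

theorem polyProj_of_neg {t : ℤ} (ht : t < 0) : polyProj σ k t = 0 := by
  rw [polyProj, if_neg ht.not_ge]

theorem polyProj_mem (t : ℤ) (f : MvPolynomial σ k) : polyProj σ k t f ∈ polyDegree σ k t := by
  rcases lt_or_ge t 0 with ht | ht
  · rw [polyProj_of_neg ht]
    exact AddSubgroup.zero_mem _
  · obtain ⟨d, rfl⟩ := Int.eq_ofNat_of_zero_le ht
    rw [polyProj_natCast, mem_polyDegree_natCast]
    exact homogeneousComponent_isHomogeneous d f

theorem polyProj_eq_self {t : ℤ} {f : MvPolynomial σ k} (hf : f ∈ polyDegree σ k t) :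
    polyProj σ k t f = f := by
  rcases mem_polyDegree.1 hf with rfl | ⟨d, rfl, hd⟩
  · exact map_zero _
  · rw [polyProj_natCast, homogeneousComponent_eq_self hd]

theorem homogeneousComponent_X_mul (d : ℕ) (j : σ) (f : MvPolynomial σ k) :
    homogeneousComponent (d + 1) (X j * f) = X j * homogeneousComponent d f := by
  classical
  ext e
  rw [coeff_homogeneousComponent, coeff_X_mul', coeff_X_mul', coeff_homogeneousComponent]
  by_cases hj : j ∈ e.support
  · rw [if_pos hj, if_pos hj]
    have he : e = (e - Finsupp.single j 1) + Finsupp.single j 1 := by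
      rw [tsub_add_cancel_of_le]
      exact Finsupp.single_le_iff.2 (Nat.one_le_iff_ne_zero.2 (Finsupp.mem_support_iff.1 hj))
    have hdeg : e.degree = (e - Finsupp.single j 1).degree + 1 := by
      conv_lhs => rw [he]
      rw [map_add, Finsupp.degree_single]
    simp [hdeg]
  · simp [hj]

theorem polyProj_X_mul (t : ℤ) (j : σ) (f : MvPolynomial σ k) :
    polyProj σ k (t + 1) (X j * f) = X j * polyProj σ k t f := by
  rcases lt_trichotomy (t + 1) 0 with ht | ht | ht
  · rw [polyProj_of_neg ht, polyProj_of_neg (by omega)]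
    simp
  · rw [ht, polyProj_of_neg (show t < 0 by omega)]
    have := polyProj_natCast (σ := σ) (k := k) 0 (X j * f)
    rw [Nat.cast_zero] at this
    rw [this, homogeneousComponent_zero]
    simp [← constantCoeff_eq]
  · obtain ⟨d, rfl⟩ := Int.eq_ofNat_of_zero_le (show 0 ≤ t by omega)
    have := polyProj_natCast (σ := σ) (k := k) (d + 1) (X j * f)
    push_cast at this
    rw [this, polyProj_natCast, homogeneousComponent_X_mul]

theorem sum_polyProj (f : MvPolynomial σ k) {T : Finset ℤ}
    (hT : (Finset.range (f.totalDegree + 1)).image (fun d : ℕ => (d : ℤ)) ⊆ T) :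
    ∑ t ∈ T, polyProj σ k t f = f := by
  rw [← Finset.sum_subset hT]
  · rw [Finset.sum_image fun _ _ _ _ h => Nat.cast_injective h]
    simp only [polyProj_natCast]
    exact sum_homogeneousComponent f
  · intro t _ ht
    rcases lt_or_ge t 0 with h0 | h0
    · rw [polyProj_of_neg h0, AddMonoidHom.zero_apply]
    · obtain ⟨d, rfl⟩ := Int.eq_ofNat_of_zero_le h0
      rw [polyProj_natCast]
      refine homogeneousComponent_eq_zero d f ?_
      by_contra hd
      exact ht (Finset.mem_image.2 ⟨d, Finset.mem_range.2 (by omega), rfl⟩)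

attribute [local instance] MvPolynomial.gradedAlgebra in
theorem IsHomogeneousIdeal.polyProj_mem {Q : Ideal (MvPolynomial σ k)}
    (hQ : IsHomogeneousIdeal Q) (t : ℤ) (f : MvPolynomial σ k) (hf : f ∈ Q) :
    polyProj σ k t f ∈ Q := by
  rcases lt_or_ge t 0 with ht | ht
  · rw [polyProj_of_neg ht]
    exact Q.zero_mem
  · obtain ⟨d, rfl⟩ := Int.eq_ofNat_of_zero_le ht
    rw [polyProj_natCast]
    exact homogeneousComponent_mem_of_mem hQ hf d

/-- The residue class ring of a homogeneous ideal is graded. -/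
theorem IsHomogeneousIdeal.isGradedBy {Q : Ideal (MvPolynomial σ k)}
    (hQ : IsHomogeneousIdeal Q) :
    IsGradedBy (fun j : σ => (X j : MvPolynomial σ k)) (quotDegree Q)
      fun t => quotMap (polyProj σ k t) (hQ.polyProj_mem t) where
  mem t n := by
    obtain ⟨f, rfl⟩ := Ideal.Quotient.mk_surjective n
    exact mk_mem_quotDegree Q (GradedLocalCohomology.polyProj_mem t f)
  eq_self t n hn := by
    obtain ⟨f, hf, rfl⟩ := hn
    exact congrArg (Ideal.Quotient.mk Q) (polyProj_eq_self hf)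
  smul t j n := by
    obtain ⟨f, rfl⟩ := Ideal.Quotient.mk_surjective n
    rw [smul_mk, quotMap_mk, quotMap_mk, smul_mk, polyProj_X_mul]
  exists_sum n := by
    obtain ⟨f, rfl⟩ := Ideal.Quotient.mk_surjective n
    refine ⟨(Finset.range (f.totalDegree + 1)).image (fun d : ℕ => (d : ℤ)), fun T hT => ?_⟩
    simp only [quotMap_mk]
    rw [← map_sum, sum_polyProj f hT]

attribute [local instance] MvPolynomial.gradedAlgebra in
theorem isHomogeneousIdeal_span {L : Set (MvPolynomial σ k)}
    (hL : ∀ l ∈ L, ∃ d, l.IsHomogeneous d) : IsHomogeneousIdeal (Ideal.span L) :=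
  Ideal.homogeneous_span _ L fun l hl => by
    obtain ⟨d, hd⟩ := hL l hl
    exact ⟨d, hd⟩

attribute [local instance] MvPolynomial.gradedAlgebra in
theorem IsHomogeneousIdeal.add {Q Q' : Ideal (MvPolynomial σ k)} (h : IsHomogeneousIdeal Q)
    (h' : IsHomogeneousIdeal Q') : IsHomogeneousIdeal (Q + Q') :=
  Ideal.IsHomogeneous.sup h h'

attribute [local instance] MvPolynomial.gradedAlgebra in
theorem IsHomogeneousIdeal.pow {Q : Ideal (MvPolynomial σ k)} (h : IsHomogeneousIdeal Q)
    (n : ℕ) : IsHomogeneousIdeal (Q ^ n) := by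
  induction n with
  | zero =>
    rw [pow_zero, Ideal.one_eq_top]
    exact Ideal.IsHomogeneous.top _
  | succ n ih =>
    rw [pow_succ]
    exact Ideal.IsHomogeneous.mul ih h

attribute [local instance] MvPolynomial.gradedAlgebra in
theorem IsHomogeneousIdeal.map_rename {τ : Type*} (f : σ → τ) {Q : Ideal (MvPolynomial σ k)}
    (h : IsHomogeneousIdeal Q) :
    IsHomogeneousIdeal (Q.map (rename (R := k) f)) := by
  obtain ⟨L, rfl⟩ := (Ideal.IsHomogeneous.iff_exists _ _).1 h
  rw [Ideal.map_span]
  refine isHomogeneousIdeal_span ?_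
  rintro _ ⟨_, ⟨⟨l, d, hl⟩, -, rfl⟩, rfl⟩
  exact ⟨d, IsHomogeneous.rename_isHomogeneous hl⟩

end Quotients

/-! ### Expansion in powers of `x_{m+1} - ℓ` -/

section LastVariable

variable {k : Type*} [Field k] {m : ℕ}

/-- The inclusion `k[x₁, …, x_m] → k[x₁, …, x_{m+1}]`. -/
noncomputable abbrev inclLast (m : ℕ) (k : Type*) [Field k] :
    MvPolynomial (Fin m) k →ₐ[k] MvPolynomial (Fin (m + 1)) k :=
  rename Fin.castSucc

/-- The polynomial `x_{m+1} - ℓ`, where `ℓ` does not involve the last variable `x_{m+1}`. -/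
noncomputable def lastSub (ℓ : MvPolynomial (Fin m) k) : MvPolynomial (Fin (m + 1)) k :=
  X (Fin.last m) - inclLast m k ℓ

theorem lastSub_zero : lastSub (0 : MvPolynomial (Fin m) k) = X (Fin.last m) := by
  rw [lastSub, map_zero, sub_zero]

/-- The expansion of a polynomial in powers of `x_{m+1} - ℓ`, with coefficients not involving
`x_{m+1}`. -/
noncomputable def expandLast (ℓ : MvPolynomial (Fin m) k) :
    MvPolynomial (Fin (m + 1)) k →ₐ[k] Polynomial (MvPolynomial (Fin m) k) :=
  aeval (Fin.lastCases (Polynomial.X + Polynomial.C ℓ) fun j => Polynomial.C (X j))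

variable (ℓ : MvPolynomial (Fin m) k)

theorem expandLast_X_last : expandLast ℓ (X (Fin.last m)) = Polynomial.X + Polynomial.C ℓ := by
  rw [expandLast, aeval_X, Fin.lastCases_last]

theorem expandLast_X_castSucc (j : Fin m) :
    expandLast ℓ (X j.castSucc) = Polynomial.C (X j) := by
  rw [expandLast, aeval_X, Fin.lastCases_castSucc]

theorem expandLast_incl (c : MvPolynomial (Fin m) k) :
    expandLast ℓ (inclLast m k c) = Polynomial.C c := by
  induction c using MvPolynomial.induction_on with
  | C a =>
    rw [inclLast, rename_C, expandLast, aeval_C]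
    rfl
  | add p q hp hq => rw [map_add, map_add, hp, hq, Polynomial.C_add]
  | mul_X p j hp => rw [map_mul, map_mul, hp, rename_X, expandLast_X_castSucc, Polynomial.C_mul]

theorem expandLast_lastSub : expandLast ℓ (lastSub ℓ) = Polynomial.X := by
  rw [lastSub, map_sub, expandLast_X_last, expandLast_incl, add_sub_cancel_right]

theorem eval₂_expandLast (f : MvPolynomial (Fin (m + 1)) k) :
    (expandLast ℓ f).eval₂ (inclLast m k : _ →+* _) (lastSub ℓ) = f := by
  induction f using MvPolynomial.induction_on with
  | C a =>
    rw [expandLast, aeval_C, Polynomial.algebraMap_apply, Polynomial.eval₂_C]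
    exact rename_C _ a
  | add p q hp hq => rw [map_add, Polynomial.eval₂_add, hp, hq]
  | mul_X p j hp =>
    rw [map_mul, Polynomial.eval₂_mul, hp]
    congr 1
    induction j using Fin.lastCases with
    | last =>
      rw [expandLast_X_last, Polynomial.eval₂_add, Polynomial.eval₂_X, Polynomial.eval₂_C, lastSub]
      exact sub_add_cancel _ _
    | cast j =>
      rw [expandLast_X_castSucc, Polynomial.eval₂_C]
      exact rename_X _ _

theorem expandLast_bijective : Function.Bijective (expandLast ℓ) := by
  refine ⟨fun f g h => ?_, fun p => ?_⟩
  · rw [← eval₂_expandLast ℓ f, h, eval₂_expandLast]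
  · induction p using Polynomial.induction_on' with
    | add p q hp hq =>
      obtain ⟨f, rfl⟩ := hp
      obtain ⟨g, rfl⟩ := hq
      exact ⟨f + g, map_add _ _ _⟩
    | monomial e c =>
      refine ⟨inclLast m k c * lastSub ℓ ^ e, ?_⟩
      rw [map_mul, map_pow, expandLast_incl, expandLast_lastSub, Polynomial.C_mul_X_pow_eq_monomial]

/-- The coefficient of `(x_{m+1} - ℓ) ^ e` in a polynomial. -/
noncomputable def coeffLast (e : ℕ) : MvPolynomial (Fin (m + 1)) k →+ MvPolynomial (Fin m) k :=
  (Polynomial.lcoeff (MvPolynomial (Fin m) k) e).toAddMonoidHom.comp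
    (expandLast ℓ : _ →+* Polynomial (MvPolynomial (Fin m) k)).toAddMonoidHom

theorem coeffLast_apply (e : ℕ) (f : MvPolynomial (Fin (m + 1)) k) :
    coeffLast ℓ e f = (expandLast ℓ f).coeff e :=
  rfl

/-- The multiple of `(x_{m+1} - ℓ) ^ e` by a polynomial not involving `x_{m+1}`. -/
noncomputable def monomialLast (e : ℕ) : MvPolynomial (Fin m) k →+ MvPolynomial (Fin (m + 1)) k :=
  (AddMonoidHom.mulRight (lastSub ℓ ^ e)).comp (inclLast m k : _ →+* _).toAddMonoidHom

theorem monomialLast_apply (e : ℕ) (c : MvPolynomial (Fin m) k) :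
    monomialLast ℓ e c = inclLast m k c * lastSub ℓ ^ e :=
  rfl

theorem coeffLast_X_castSucc_mul (e : ℕ) (j : Fin m) (f : MvPolynomial (Fin (m + 1)) k) :
    coeffLast ℓ e (X j.castSucc * f) = X j * coeffLast ℓ e f := by
  rw [coeffLast_apply, map_mul, expandLast_X_castSucc, Polynomial.coeff_C_mul, coeffLast_apply]

theorem monomialLast_X_mul (e : ℕ) (j : Fin m) (c : MvPolynomial (Fin m) k) :
    monomialLast ℓ e (X j * c) = X j.castSucc * monomialLast ℓ e c := by
  rw [monomialLast_apply, map_mul, rename_X, mul_assoc, monomialLast_apply]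

theorem coeffLast_monomialLast (e e' : ℕ) (c : MvPolynomial (Fin m) k) :
    coeffLast ℓ e (monomialLast ℓ e' c) = if e = e' then c else 0 := by
  rw [coeffLast_apply, monomialLast_apply, map_mul, map_pow, expandLast_incl, expandLast_lastSub,
    Polynomial.coeff_C_mul_X_pow]

theorem coeffLast_succ_lastSub_mul (e : ℕ) (f : MvPolynomial (Fin (m + 1)) k) :
    coeffLast ℓ (e + 1) (lastSub ℓ * f) = coeffLast ℓ e f := by
  rw [coeffLast_apply, map_mul, expandLast_lastSub, Polynomial.coeff_X_mul, coeffLast_apply]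

theorem coeffLast_zero_lastSub_mul (f : MvPolynomial (Fin (m + 1)) k) :
    coeffLast ℓ 0 (lastSub ℓ * f) = 0 := by
  rw [coeffLast_apply, map_mul, expandLast_lastSub, Polynomial.coeff_X_mul_zero]

theorem exists_sum_monomialLast (f : MvPolynomial (Fin (m + 1)) k) :
    ∃ K, ∀ K', K ≤ K' → ∑ e ∈ Finset.range K', monomialLast ℓ e (coeffLast ℓ e f) = f := by
  refine ⟨(expandLast ℓ f).natDegree + 1, fun K' hK => ?_⟩
  conv_rhs => rw [← eval₂_expandLast ℓ f]
  rw [Polynomial.eval₂_eq_sum_range' _ (show (expandLast ℓ f).natDegree < K' by omega)]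
  rfl

/-- If `ℓ` is a linear form, the coefficient of `(x_{m+1} - ℓ) ^ e` in a homogeneous polynomial of
degree `t` is homogeneous of degree `t - e`. -/
theorem coeffLast_mem_polyDegree {ℓ : MvPolynomial (Fin m) k} (hℓ : ℓ.IsHomogeneous 1) (e : ℕ)
    {t : ℤ} {f : MvPolynomial (Fin (m + 1)) k} (hf : f ∈ polyDegree (Fin (m + 1)) k t) :
    coeffLast ℓ e f ∈ polyDegree (Fin m) k (t - e) := by
  have hX : ∀ j, ∀ e : ℕ, coeffLast ℓ e (X j) ∈ polyDegree (Fin m) k (1 - e) := by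
    intro j e
    induction j using Fin.lastCases with
    | last =>
      rw [coeffLast_apply, expandLast_X_last, Polynomial.coeff_add, Polynomial.coeff_X,
        Polynomial.coeff_C]
      rcases e with _ | _ | e
      · simpa using mem_polyDegree_natCast.2 hℓ
      · simpa using mem_polyDegree_natCast.2 (isHomogeneous_one (Fin m) k)
      · simp
    | cast j =>
      rw [coeffLast_apply, expandLast_X_castSucc, Polynomial.coeff_C]
      split_ifs with he
      · subst he
        simpa using mem_polyDegree_natCast.2 (isHomogeneous_X k j)
      · exact AddSubgroup.zero_mem _
  have h1 : ∀ g ∈ homogeneousSubmodule (Fin (m + 1)) k 1, ∀ e : ℕ,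
      coeffLast ℓ e g ∈ polyDegree (Fin m) k (1 - e) := by
    intro g hg e
    rw [homogeneousSubmodule_one_eq_span_X] at hg
    induction hg using Submodule.span_induction with
    | mem g hg =>
      obtain ⟨j, rfl⟩ := hg
      exact hX j e
    | zero => rw [map_zero]; exact AddSubgroup.zero_mem _
    | add g g' _ _ hg hg' => rw [map_add]; exact AddSubgroup.add_mem _ hg hg'
    | smul a g _ hg =>
      rw [coeffLast_apply, map_smul, Polynomial.coeff_smul, MvPolynomial.smul_eq_C_mul]
      have := mul_mem_polyDegree (mem_polyDegree_natCast.2 (isHomogeneous_C (Fin m) a)) hg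
      rwa [Nat.cast_zero, zero_add] at this
  rcases mem_polyDegree.1 hf with rfl | ⟨d, rfl, hd⟩
  · rw [map_zero]
    exact AddSubgroup.zero_mem _
  · rw [← mem_homogeneousSubmodule, ← homogeneousSubmodule_one_pow] at hd
    clear hf
    induction hd using Submodule.pow_induction_on_left' generalizing e with
    | algebraMap a =>
      rw [coeffLast_apply, AlgHom.commutes, Polynomial.algebraMap_apply, Polynomial.coeff_C]
      split_ifs with he
      · subst he
        simpa using mem_polyDegree_natCast.2 (isHomogeneous_C (Fin m) a)
      · exact AddSubgroup.zero_mem _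
    | add f g i _ _ hf hg => rw [map_add]; exact AddSubgroup.add_mem _ (hf e) (hg e)
    | mem_mul g hg i f _ hf =>
      rw [coeffLast_apply, map_mul, Polynomial.coeff_mul]
      refine AddSubgroup.sum_mem _ fun a ha => ?_
      have := mul_mem_polyDegree (h1 g hg a.1) (hf a.2)
      have he := Finset.HasAntidiagonal.mem_antidiagonal.1 ha
      have hdeg : ((i.succ : ℕ) : ℤ) - e = 1 - a.1 + (i - a.2) := by
        rw [← he]
        push_cast
        ring
      rw [hdeg]
      exact this

theorem lastSub_isHomogeneous {ℓ : MvPolynomial (Fin m) k} (hℓ : ℓ.IsHomogeneous 1) :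
    (lastSub ℓ).IsHomogeneous 1 :=
  (isHomogeneous_X k _).sub hℓ.rename_isHomogeneous

theorem monomialLast_mem_polyDegree {ℓ : MvPolynomial (Fin m) k} (hℓ : ℓ.IsHomogeneous 1) (e : ℕ)
    {t : ℤ} {c : MvPolynomial (Fin m) k} (hc : c ∈ polyDegree (Fin m) k t) :
    monomialLast ℓ e c ∈ polyDegree (Fin (m + 1)) k (t + e) := by
  rw [monomialLast_apply]
  refine mul_mem_polyDegree ?_ (mem_polyDegree_natCast.2 ?_)
  · rcases mem_polyDegree.1 hc with rfl | ⟨d, rfl, hd⟩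
    · rw [map_zero]
      exact AddSubgroup.zero_mem _
    · exact mem_polyDegree_natCast.2 hd.rename_isHomogeneous
  · simpa using (lastSub_isHomogeneous hℓ).pow e

/-- The extension of an ideal of `k[x₁, …, x_m]` to `k[x₁, …, x_{m+1}]`. -/
noncomputable abbrev extLast (Q : Ideal (MvPolynomial (Fin m) k)) :
    Ideal (MvPolynomial (Fin (m + 1)) k) :=
  Q.map (inclLast m k)

variable (Q : Ideal (MvPolynomial (Fin m) k))

theorem coeffLast_mem_of_mem_extLast (e : ℕ) (f : MvPolynomial (Fin (m + 1)) k)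
    (hf : f ∈ extLast Q) : coeffLast ℓ e f ∈ Q := by
  have hle : extLast Q ≤ (Q.map Polynomial.C).comap (expandLast ℓ) := by
    rw [Ideal.map_le_iff_le_comap]
    intro c hc
    rw [Ideal.mem_comap, Ideal.mem_comap, expandLast_incl]
    exact Ideal.mem_map_of_mem _ hc
  exact Ideal.mem_map_C_iff.1 (hle hf) e

theorem monomialLast_mem_extLast (e : ℕ) (c : MvPolynomial (Fin m) k) (hc : c ∈ Q) :
    monomialLast ℓ e c ∈ extLast Q := by
  rw [monomialLast_apply]
  exact Ideal.mul_mem_right _ _ (Ideal.mem_map_of_mem _ hc)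

/-- The ideal of the polynomials whose coefficient of degree `e` lies in `Q ^ (n - e)`. -/
def coeffIdeal {R : Type*} [CommRing R] (Q : Ideal R) (n : ℕ) : Ideal (Polynomial R) where
  carrier := {g | ∀ e, g.coeff e ∈ Q ^ (n - e)}
  add_mem' hf hg e := by
    rw [Polynomial.coeff_add]
    exact Ideal.add_mem _ (hf e) (hg e)
  zero_mem' e := by
    rw [Polynomial.coeff_zero]
    exact Ideal.zero_mem _
  smul_mem' f g hg e := by
    rw [smul_eq_mul, Polynomial.coeff_mul]
    refine Ideal.sum_mem _ fun a ha => Ideal.mul_mem_left _ _ ?_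
    have := Finset.HasAntidiagonal.mem_antidiagonal.1 ha
    exact Ideal.pow_le_pow_right (by omega) (hg a.2)

theorem coeffIdeal_one_pow_le {R : Type*} [CommRing R] (Q : Ideal R) (n : ℕ) :
    coeffIdeal Q 1 ^ n ≤ coeffIdeal Q n := by
  induction n with
  | zero => exact fun f _ e => by simp
  | succ n ih =>
    rw [pow_succ', Ideal.mul_le]
    intro f hf g hg e
    rw [Polynomial.coeff_mul]
    refine Ideal.sum_mem _ fun a ha => ?_
    have := Finset.HasAntidiagonal.mem_antidiagonal.1 ha
    have h := Ideal.mul_mem_mul (hf a.1) (ih hg a.2)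
    rw [← pow_add] at h
    exact Ideal.pow_le_pow_right (by omega) h

/-- The coefficients of the elements of `(Q + (x_{m+1} - ℓ)) ^ n` lie in powers of `Q`. -/
theorem coeffLast_mem_pow (n e : ℕ) (f : MvPolynomial (Fin (m + 1)) k)
    (hf : f ∈ (extLast Q + Ideal.span {lastSub ℓ}) ^ n) : coeffLast ℓ e f ∈ Q ^ (n - e) := by
  have hle : extLast Q + Ideal.span {lastSub ℓ} ≤ (coeffIdeal Q 1).comap (expandLast ℓ) := by
    rw [Submodule.add_eq_sup]
    refine sup_le (fun f hf e => ?_) ?_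
    · have := coeffLast_mem_of_mem_extLast ℓ Q e f hf
      rcases e with _ | e
      · simpa [coeffLast_apply] using this
      · simp
    · rw [Ideal.span_singleton_le_iff_mem]
      intro e
      rw [expandLast_lastSub]
      rcases e with _ | e
      · simp
      · simp
  exact coeffIdeal_one_pow_le Q n
    (Ideal.le_comap_pow (expandLast ℓ) n (Ideal.pow_right_mono hle n hf)) e

theorem monomialLast_mem_pow (n e : ℕ) (c : MvPolynomial (Fin m) k) (hc : c ∈ Q ^ (n - e)) :
    monomialLast ℓ e c ∈ (extLast Q + Ideal.span {lastSub ℓ}) ^ n := by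
  have h₁ : inclLast m k c ∈ (extLast Q + Ideal.span {lastSub ℓ}) ^ (n - e) := by
    have := Ideal.mem_map_of_mem (inclLast m k) hc
    rw [Ideal.map_pow] at this
    exact Ideal.pow_right_mono le_sup_left _ this
  have h₂ : lastSub ℓ ^ e ∈ (extLast Q + Ideal.span {lastSub ℓ}) ^ e :=
    Ideal.pow_mem_pow (Ideal.mem_sup_right (Ideal.mem_span_singleton_self _)) e
  have h₃ := Ideal.mul_mem_mul h₁ h₂
  rw [← pow_add] at h₃
  exact Ideal.pow_le_pow_right (by omega) h₃

end LastVariable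

/-! ### Depth and regularity after adjoining one variable -/

section Invariants

variable {k : Type*} [Field k] {m : ℕ}

/-- The vanishing of `[H^i_𝔪(R/Q)]_t`, where `R = k[x₁, …, x_m]`. -/
def VanishesAt (Q : Ideal (MvPolynomial (Fin m) k)) (i : ℕ) (t : ℤ) : Prop :=
  CechVanishes (fun j : Fin m => (X j : MvPolynomial (Fin m) k)) (quotDegree Q) i t

theorem le_depthQuot_iff {Q : Ideal (MvPolynomial (Fin m) k)} (hQ : IsHomogeneousIdeal Q)
    {a : ℕ∞} : a ≤ depthQuot Q ↔ ∀ i t, ¬ VanishesAt Q i t → a ≤ i := by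
  simp only [depthQuot, depth, le_iInf_iff, nontrivial_localCohomology_iff hQ.isGradedBy]
  exact ⟨fun h i t ht => h i ⟨t, ht⟩, fun h i ⟨t, ht⟩ => h i t ht⟩

theorem regQuot_le_iff {Q : Ideal (MvPolynomial (Fin m) k)} {b : EReal} :
    regQuot Q ≤ b ↔ ∀ i t, ¬ VanishesAt Q i t → (((t + i : ℤ) : ℝ) : EReal) ≤ b := by
  unfold regQuot reg aInvariant
  simp only [iSup_le_iff]
  refine forall_congr' fun i => ?_
  rw [← EReal.le_sub_iff_add_le (Or.inl (EReal.coe_ne_bot _)) (Or.inl (EReal.coe_ne_top _))]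
  simp only [iSup_le_iff]
  refine forall_congr' fun t => ?_
  rw [Ne, localCohomologyDegree_eq_bot_iff (smul_mem_quotDegree Q)]
  refine imp_congr Iff.rfl ?_
  rw [EReal.le_sub_iff_add_le (Or.inl (EReal.coe_ne_bot _)) (Or.inl (EReal.coe_ne_top _)),
    ← EReal.coe_add]
  push_cast
  rfl

theorem depthQuot_le {Q : Ideal (MvPolynomial (Fin m) k)} (hQ : IsHomogeneousIdeal Q) {i : ℕ}
    {t : ℤ} (h : ¬ VanishesAt Q i t) : depthQuot Q ≤ i :=
  (le_depthQuot_iff hQ).1 le_rfl i t h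

theorem le_regQuot {Q : Ideal (MvPolynomial (Fin m) k)} {i : ℕ} {t : ℤ}
    (h : ¬ VanishesAt Q i t) : (((t + i : ℤ) : ℝ) : EReal) ≤ regQuot Q :=
  regQuot_le_iff.1 le_rfl i t h

end Invariants

section AdjoinVariable

variable {k : Type*} [Field k] {m : ℕ} (Q : Ideal (MvPolynomial (Fin m) k))

theorem isPolynomialExtension_extLast :
    IsPolynomialExtension (fun j : Fin (m + 1) => (X j : MvPolynomial (Fin (m + 1)) k))
      (quotDegree (extLast Q)) (fun j : Fin m => (X j : MvPolynomial (Fin m) k)) (quotDegree Q)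
      (fun e => quotMap (coeffLast 0 e) (coeffLast_mem_of_mem_extLast 0 Q e))
      (fun e => quotMap (monomialLast 0 e) (monomialLast_mem_extLast 0 Q e)) where
  coeff_smul e j q := by
    obtain ⟨f, rfl⟩ := Ideal.Quotient.mk_surjective q
    rw [smul_mk, quotMap_mk, quotMap_mk, smul_mk, coeffLast_X_castSucc_mul]
  monomial_smul e j n := by
    obtain ⟨c, rfl⟩ := Ideal.Quotient.mk_surjective n
    rw [smul_mk, quotMap_mk, quotMap_mk, smul_mk, monomialLast_X_mul]
  coeff_succ_smul e q := by
    obtain ⟨f, rfl⟩ := Ideal.Quotient.mk_surjective q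
    rw [smul_mk, quotMap_mk, quotMap_mk, ← lastSub_zero, coeffLast_succ_lastSub_mul]
  coeff_zero_smul q := by
    obtain ⟨f, rfl⟩ := Ideal.Quotient.mk_surjective q
    rw [smul_mk, quotMap_mk, ← lastSub_zero, coeffLast_zero_lastSub_mul, map_zero]
  monomial_succ e n := by
    obtain ⟨c, rfl⟩ := Ideal.Quotient.mk_surjective n
    rw [quotMap_mk, quotMap_mk, smul_mk, ← lastSub_zero, monomialLast_apply, monomialLast_apply,
      pow_succ', mul_left_comm]
  coeff_monomial e e' n := by
    obtain ⟨c, rfl⟩ := Ideal.Quotient.mk_surjective n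
    rw [quotMap_mk, quotMap_mk, coeffLast_monomialLast]
    split_ifs
    · rfl
    · exact map_zero _
  exists_sum q := by
    obtain ⟨f, rfl⟩ := Ideal.Quotient.mk_surjective q
    obtain ⟨K, hK⟩ := exists_sum_monomialLast 0 f
    refine ⟨K, ?_⟩
    simp only [quotMap_mk]
    rw [← map_sum, hK K le_rfl]
  coeff_mem e _ _ hq :=
    quotMap_mem_quotDegree _ _
      (fun _ ha => coeffLast_mem_polyDegree (isHomogeneous_zero _ _ _) e ha) hq
  monomial_mem e _ _ hn :=
    quotMap_mem_quotDegree _ _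
      (fun _ ha => monomialLast_mem_polyDegree (isHomogeneous_zero _ _ _) e ha) hn

/-- The cohomology of `k[x₁, …, x_{m+1}]/Q` is that of `k[x₁, …, x_m]/Q`, moved up by one
cohomological degree and spread over the lower internal degrees. -/
theorem not_vanishesAt_extLast_iff (hQ : IsHomogeneousIdeal Q) (i : ℕ) (t : ℤ) :
    ¬ VanishesAt (extLast Q) i t ↔
      ∃ i', i = i' + 1 ∧ ∃ e : ℕ, 1 ≤ e ∧ ¬ VanishesAt Q i' (t + e) := by
  have h := isPolynomialExtension_extLast Q
  rcases i with _ | i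
  · simp [VanishesAt, h.cechVanishes_zero t]
  · rw [VanishesAt, h.cechVanishes_succ_iff hQ.isGradedBy]
    simp [VanishesAt]

theorem depthQuot_extLast (hQ : IsHomogeneousIdeal Q) :
    depthQuot (extLast Q) = depthQuot Q + 1 := by
  refine le_antisymm ?_ ?_
  · rw [← tsub_le_iff_right, le_depthQuot_iff hQ]
    intro i t h
    rw [tsub_le_iff_right]
    refine (depthQuot_le (hQ.map_rename _) (i := i + 1) (t := t - 1) ?_).trans (by simp)
    exact (not_vanishesAt_extLast_iff Q hQ _ _).2 ⟨i, rfl, 1, le_rfl, by simpa using h⟩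
  · rw [le_depthQuot_iff (hQ.map_rename _)]
    intro i t h
    obtain ⟨i, rfl, e, -, h⟩ := (not_vanishesAt_extLast_iff Q hQ _ _).1 h
    push_cast
    gcongr
    exact depthQuot_le hQ h

theorem regQuot_extLast (hQ : IsHomogeneousIdeal Q) : regQuot (extLast Q) = regQuot Q := by
  refine le_antisymm ?_ ?_
  · rw [regQuot_le_iff]
    intro i t h
    obtain ⟨i, rfl, e, he, h⟩ := (not_vanishesAt_extLast_iff Q hQ _ _).1 h
    refine le_trans ?_ (le_regQuot h)
    rw [EReal.coe_le_coe_iff, Int.cast_le]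
    push_cast
    omega
  · rw [regQuot_le_iff]
    intro i t h
    refine le_trans (le_of_eq ?_) (le_regQuot (Q := extLast Q) (i := i + 1) (t := t - 1) ?_)
    · congr 2
      push_cast
      ring
    · exact (not_vanishesAt_extLast_iff Q hQ _ _).2 ⟨i, rfl, 1, le_rfl, by simpa using h⟩

end AdjoinVariable

/-! ### Adjoining a linear form and taking powers -/

section AdjoinForm

variable {k : Type*} [Field k] {m : ℕ} (Q : Ideal (MvPolynomial (Fin m) k))
  {ℓ : MvPolynomial (Fin m) k}

theorem isHomogeneousIdeal_add_lastSub {Q : Ideal (MvPolynomial (Fin m) k)}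
    (hQ : IsHomogeneousIdeal Q) (hℓ : ℓ.IsHomogeneous 1) :
    IsHomogeneousIdeal (extLast Q + Ideal.span {lastSub ℓ}) :=
  (hQ.map_rename _).add (isHomogeneousIdeal_span fun _ hl =>
    ⟨1, Set.mem_singleton_iff.1 hl ▸ lastSub_isHomogeneous hℓ⟩)

theorem mem_span_X_of_isHomogeneous {σ : Type*} {f : MvPolynomial σ k} (hf : f.IsHomogeneous 1) :
    f ∈ Ideal.span (Set.range (X : σ → MvPolynomial σ k)) := by
  rw [← mem_homogeneousSubmodule, homogeneousSubmodule_one_eq_span_X] at hf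
  exact Submodule.span_le_restrictScalars k _ _ hf

/-- Modulo `(x_{m+1} - ℓ) ^ n`, the last variable agrees with `ℓ` up to a nilpotent. -/
theorem X_last_mem_radical (hℓ : ℓ.IsHomogeneous 1) (n : ℕ) :
    (X (Fin.last m) : MvPolynomial (Fin (m + 1)) k) ∈
      (Ideal.span (Set.range fun j : Fin m => (X j.castSucc : MvPolynomial (Fin (m + 1)) k)) ⊔
        Module.annihilator (MvPolynomial (Fin (m + 1)) k)
          (MvPolynomial (Fin (m + 1)) k ⧸ (extLast Q + Ideal.span {lastSub ℓ}) ^ n)).radical := by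
  have h : (X (Fin.last m) : MvPolynomial (Fin (m + 1)) k) = inclLast m k ℓ + lastSub ℓ := by
    rw [lastSub]
    ring
  rw [h]
  refine Ideal.add_mem _ (Ideal.le_radical (Ideal.mem_sup_left ?_)) ⟨n, Ideal.mem_sup_right ?_⟩
  · have := Ideal.mem_map_of_mem (inclLast m k) (mem_span_X_of_isHomogeneous hℓ)
    rw [Ideal.map_span, ← Set.range_comp] at this
    convert this using 3
    funext j
    exact (rename_X _ _).symm
  · rw [Ideal.annihilator_quotient]
    exact Ideal.pow_mem_pow (Ideal.mem_sup_right (Ideal.mem_span_singleton_self _)) n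

/-- As a module over `k[x₁, …, x_m]`, the residue class ring of `(Q + (x_{m+1} - ℓ)) ^ n` is the
direct sum of the `k[x₁, …, x_m]/Q ^ (n - e)`, shifted by `e`, for `e < n`. -/
theorem vanishesAt_add_lastSub_pow_iff (hQ : IsHomogeneousIdeal Q) (hℓ : ℓ.IsHomogeneous 1)
    (n i : ℕ) (t : ℤ) :
    VanishesAt ((extLast Q + Ideal.span {lastSub ℓ}) ^ n) i t ↔
      ∀ e < n, VanishesAt (Q ^ (n - e)) i (t - e) := by
  let φ : ∀ e : ℕ, MvPolynomial (Fin (m + 1)) k ⧸ (extLast Q + Ideal.span {lastSub ℓ}) ^ n →+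
      MvPolynomial (Fin m) k ⧸ Q ^ (n - e) :=
    fun e => quotMap (coeffLast ℓ e) (coeffLast_mem_pow ℓ Q n e)
  let ψ : ∀ e : ℕ, MvPolynomial (Fin m) k ⧸ Q ^ (n - e) →+
      MvPolynomial (Fin (m + 1)) k ⧸ (extLast Q + Ideal.span {lastSub ℓ}) ^ n :=
    fun e => quotMap (monomialLast ℓ e) (monomialLast_mem_pow ℓ Q n e)
  have hφ : ∀ (e : ℕ) (j : Fin m) q, φ e ((X j.castSucc : MvPolynomial (Fin (m + 1)) k) • q) =
      (X j : MvPolynomial (Fin m) k) • φ e q := by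
    intro e j q
    obtain ⟨f, rfl⟩ := Ideal.Quotient.mk_surjective q
    simp only [φ]
    rw [smul_mk, quotMap_mk, quotMap_mk, smul_mk, coeffLast_X_castSucc_mul]
  have hψ : ∀ (e : ℕ) (j : Fin m) q, ψ e ((X j : MvPolynomial (Fin m) k) • q) =
      (X j.castSucc : MvPolynomial (Fin (m + 1)) k) • ψ e q := by
    intro e j n
    obtain ⟨c, rfl⟩ := Ideal.Quotient.mk_surjective n
    simp only [ψ]
    rw [smul_mk, quotMap_mk, quotMap_mk, smul_mk, monomialLast_X_mul]
  rw [VanishesAt, cechVanishes_iff_of_mem_radical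
    ((isHomogeneousIdeal_add_lastSub hQ hℓ).pow n).isGradedBy (X_last_mem_radical Q hℓ n)]
  constructor
  · intro h e _
    refine CechVanishes.of_retract (φ e) (hφ e) (ψ e) (hψ e) (fun q => ?_) e
      (fun u q hq => quotMap_mem_quotDegree _ _
        (fun _ ha => monomialLast_mem_polyDegree hℓ e ha) hq) (by rwa [sub_add_cancel])
    obtain ⟨c, rfl⟩ := Ideal.Quotient.mk_surjective q
    simp only [φ, ψ]
    rw [quotMap_mk, quotMap_mk, coeffLast_monomialLast, if_pos rfl]
  · intro h
    refine CechVanishes.of_sum (Finset.range n) φ hφ ψ hψ (fun q => ?_) (fun e => (e : ℤ))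
      (fun e _ u q hq => ?_) fun e he => h e (Finset.mem_range.1 he)
    · obtain ⟨f, rfl⟩ := Ideal.Quotient.mk_surjective q
      obtain ⟨K, hK⟩ := exists_sum_monomialLast ℓ f
      simp only [φ, ψ, quotMap_mk]
      -- the summands with `n ≤ e` vanish in the quotient
      conv_rhs => rw [← hK (max K n) (le_max_left _ _), map_sum]
      refine Finset.sum_subset (Finset.range_subset_range.2 (le_max_right _ _)) fun e _ he => ?_
      rw [Ideal.Quotient.eq_zero_iff_mem]
      refine monomialLast_mem_pow ℓ Q n e _ ?_
      rw [Finset.mem_range, not_lt] at he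
      rw [Nat.sub_eq_zero_of_le he, pow_zero, Ideal.one_eq_top]
      trivial
    · have := quotMap_mem_quotDegree _ (coeffLast_mem_pow ℓ Q n e)
        (fun _ ha => coeffLast_mem_polyDegree hℓ e ha) hq
      rwa [add_sub_cancel_right] at this

theorem not_vanishesAt_add_lastSub_pow_iff (hQ : IsHomogeneousIdeal Q) (hℓ : ℓ.IsHomogeneous 1)
    (n i : ℕ) (t : ℤ) :
    ¬ VanishesAt ((extLast Q + Ideal.span {lastSub ℓ}) ^ n) i t ↔
      ∃ a ∈ Finset.Icc 1 n, ¬ VanishesAt (Q ^ a) i (t - (n - a)) := by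
  rw [vanishesAt_add_lastSub_pow_iff Q hQ hℓ]
  push Not
  constructor
  · rintro ⟨e, he, h⟩
    refine ⟨n - e, Finset.mem_Icc.2 ⟨by omega, by omega⟩, ?_⟩
    convert h using 2
    push_cast [he.le]
    ring
  · rintro ⟨a, ha, h⟩
    rw [Finset.mem_Icc] at ha
    refine ⟨n - a, by omega, ?_⟩
    rw [Nat.sub_sub_self ha.2]
    convert h using 2
    push_cast [ha.2]
    ring

theorem depthQuot_add_lastSub_pow (hQ : IsHomogeneousIdeal Q) (hℓ : ℓ.IsHomogeneous 1) (n : ℕ) :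
    depthQuot ((extLast Q + Ideal.span {lastSub ℓ}) ^ n) =
      ⨅ a ∈ Finset.Icc 1 n, depthQuot (Q ^ a) := by
  refine eq_of_forall_le_iff fun b => ?_
  simp only [le_depthQuot_iff ((isHomogeneousIdeal_add_lastSub hQ hℓ).pow n), le_iInf_iff,
    le_depthQuot_iff (hQ.pow _), not_vanishesAt_add_lastSub_pow_iff Q hQ hℓ]
  constructor
  · intro h a ha i t ht
    exact h i (t + (n - a)) ⟨a, ha, by simpa using ht⟩
  · rintro h i t ⟨a, ha, ht⟩
    exact h a ha i _ ht

theorem regQuot_add_lastSub_pow_sub (hQ : IsHomogeneousIdeal Q) (hℓ : ℓ.IsHomogeneous 1) (n : ℕ) :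
    regQuot ((extLast Q + Ideal.span {lastSub ℓ}) ^ n) - (n : EReal) =
      ⨆ a ∈ Finset.Icc 1 n, (regQuot (Q ^ a) - (a : EReal)) := by
  have key : ∀ {m' : ℕ} (Q' : Ideal (MvPolynomial (Fin m') k)) (a : ℕ) (b : EReal),
      regQuot Q' - (a : EReal) ≤ b ↔
        ∀ i t, ¬ VanishesAt Q' i t → (((t + i - a : ℤ) : ℝ) : EReal) ≤ b := by
    intro m' Q' a b
    rw [EReal.sub_le_iff_le_add (Or.inl (EReal.natCast_ne_bot a))
      (Or.inl (EReal.natCast_ne_top a)), regQuot_le_iff]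
    refine forall_congr' fun i => forall_congr' fun t => imp_congr Iff.rfl ?_
    rw [← EReal.sub_le_iff_le_add (Or.inl (EReal.natCast_ne_bot a))
      (Or.inl (EReal.natCast_ne_top a))]
    push_cast
    rfl
  refine eq_of_forall_ge_iff fun b => ?_
  simp only [iSup_le_iff, key, not_vanishesAt_add_lastSub_pow_iff Q hQ hℓ]
  constructor
  · intro h a ha i t ht
    convert h i (t + (n - a)) ⟨a, ha, by simpa using ht⟩ using 3
    ring
  · rintro h i t ⟨a, ha, ht⟩
    convert h a ha i _ ht using 3
    ring

end AdjoinForm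

/-! ### Krull dimension -/

section Dimension

variable {k : Type*} [Field k] {m : ℕ} (Q : Ideal (MvPolynomial (Fin m) k))
  (ℓ : MvPolynomial (Fin m) k)

theorem ringKrullDim_extLast :
    ringKrullDim (MvPolynomial (Fin (m + 1)) k ⧸ extLast Q) =
      ringKrullDim (MvPolynomial (Fin m) k ⧸ Q) + 1 := by
  let f : MvPolynomial (Fin (m + 1)) k →+* Polynomial (MvPolynomial (Fin m) k ⧸ Q) :=
    (Polynomial.mapRingHom (Ideal.Quotient.mk Q)).comp
      (expandLast (0 : MvPolynomial (Fin m) k) : _ →+* _)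
  have hf : ∀ g e, (f g).coeff e = Ideal.Quotient.mk Q (coeffLast 0 e g) :=
    fun g e => Polynomial.coeff_map _ _
  have hsurj : Function.Surjective f :=
    (Polynomial.map_surjective _ Ideal.Quotient.mk_surjective).comp (expandLast_bijective 0).2
  have hker : extLast Q = RingHom.ker f := by
    ext g
    rw [RingHom.mem_ker, Polynomial.ext_iff]
    simp only [hf, Polynomial.coeff_zero, Ideal.Quotient.eq_zero_iff_mem]
    constructor
    · exact fun hg e => coeffLast_mem_of_mem_extLast 0 Q e g hg
    · intro hg
      obtain ⟨K, hK⟩ := exists_sum_monomialLast 0 g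
      rw [← hK K le_rfl]
      exact Ideal.sum_mem _ fun e _ => monomialLast_mem_extLast 0 Q e _ (hg e)
  rw [ringKrullDim_eq_of_ringEquiv (Ideal.quotEquivOfEq hker),
    ringKrullDim_eq_of_ringEquiv (S := Polynomial (MvPolynomial (Fin m) k ⧸ Q))
      (RingHom.quotientKerEquivOfSurjective hsurj),
    Polynomial.ringKrullDim_of_isNoetherianRing]

theorem ringKrullDim_add_lastSub :
    ringKrullDim (MvPolynomial (Fin (m + 1)) k ⧸ (extLast Q + Ideal.span {lastSub ℓ})) =
      ringKrullDim (MvPolynomial (Fin m) k ⧸ Q) := by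
  let f : MvPolynomial (Fin (m + 1)) k →+* MvPolynomial (Fin m) k ⧸ Q :=
    (Ideal.Quotient.mk Q).comp (Polynomial.constantCoeff.comp (expandLast ℓ : _ →+* _))
  have hf : ∀ g, f g = Ideal.Quotient.mk Q (coeffLast ℓ 0 g) := fun g => rfl
  have hsurj : Function.Surjective f := by
    intro q
    obtain ⟨c, rfl⟩ := Ideal.Quotient.mk_surjective q
    exact ⟨monomialLast ℓ 0 c, by rw [hf, coeffLast_monomialLast, if_pos rfl]⟩
  have hker : extLast Q + Ideal.span {lastSub ℓ} = RingHom.ker f := by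
    ext g
    rw [RingHom.mem_ker, hf, Ideal.Quotient.eq_zero_iff_mem]
    constructor
    · intro hg
      simpa using coeffLast_mem_pow ℓ Q 1 0 g (by rwa [pow_one])
    · intro hg
      obtain ⟨K, hK⟩ := exists_sum_monomialLast ℓ g
      rw [← hK K le_rfl]
      refine Ideal.sum_mem _ fun e _ => ?_
      rw [← pow_one (extLast Q + _)]
      refine monomialLast_mem_pow ℓ Q 1 e _ ?_
      rcases e with _ | e
      · simpa using hg
      · simp
  exact ringKrullDim_eq_of_ringEquiv
    ((Ideal.quotEquivOfEq hker).trans (RingHom.quotientKerEquivOfSurjective hsurj))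

end Dimension

/-! ### Ideals generated by linear forms -/

section LinearForms

variable {k : Type*} [Field k]

/-- An ideal of a polynomial ring that is generated by linear forms. -/
def IsLinearIdeal {σ : Type*} (J : Ideal (MvPolynomial σ k)) : Prop :=
  ∃ L : Set (MvPolynomial σ k), (∀ l ∈ L, l.IsHomogeneous 1) ∧ J = Ideal.span L

theorem IsLinearIdeal.isHomogeneousIdeal {σ : Type*} {J : Ideal (MvPolynomial σ k)}
    (hJ : IsLinearIdeal J) : IsHomogeneousIdeal J := by
  obtain ⟨L, hL, rfl⟩ := hJ
  exact isHomogeneousIdeal_span fun l hl => ⟨1, hL l hl⟩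

theorem exists_eq_C_mul_X_last_add {m : ℕ} (l : MvPolynomial (Fin (m + 1)) k)
    (hl : l.IsHomogeneous 1) : ∃ (c : k) (l' : MvPolynomial (Fin m) k), l'.IsHomogeneous 1 ∧
      l = C c * X (Fin.last m) + inclLast m k l' := by
  rw [← mem_homogeneousSubmodule, homogeneousSubmodule_one_eq_span_X] at hl
  induction hl using Submodule.span_induction with
  | mem g hg =>
    obtain ⟨j, rfl⟩ := hg
    induction j using Fin.lastCases with
    | last => exact ⟨1, 0, isHomogeneous_zero _ _ _, by simp⟩
    | cast j => exact ⟨0, X j, isHomogeneous_X k j, by simp⟩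
  | zero => exact ⟨0, 0, isHomogeneous_zero _ _ _, by simp⟩
  | add g g' _ _ hg hg' =>
    obtain ⟨c, l, hl, rfl⟩ := hg
    obtain ⟨c', l', hl', rfl⟩ := hg'
    refine ⟨c + c', l + l', hl.add hl', ?_⟩
    rw [C_add, map_add]
    ring
  | smul a g _ hg =>
    obtain ⟨c, l, hl, rfl⟩ := hg
    refine ⟨a * c, C a * l, hl.C_mul a, ?_⟩
    rw [smul_eq_C_mul, C_mul, map_mul, rename_C]
    ring

/-- Gaussian elimination of the last variable: an ideal generated by linear forms is extended from
the ring without the last variable, up to possibly a generator of the form `x_{m+1} - ℓ`. -/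
theorem IsLinearIdeal.eq_extLast_or {m : ℕ} {J : Ideal (MvPolynomial (Fin (m + 1)) k)}
    (hJ : IsLinearIdeal J) :
    (∃ J' : Ideal (MvPolynomial (Fin m) k), IsLinearIdeal J' ∧ J = extLast J') ∨
      ∃ (J' : Ideal (MvPolynomial (Fin m) k)) (ℓ : MvPolynomial (Fin m) k), IsLinearIdeal J' ∧
        ℓ.IsHomogeneous 1 ∧ J = extLast J' + Ideal.span {lastSub ℓ} := by
  obtain ⟨L, hL, rfl⟩ := hJ
  choose! c l' hl' hc using fun l hl => exists_eq_C_mul_X_last_add l (hL l hl)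
  by_cases h0 : ∀ l ∈ L, c l = 0
  · refine Or.inl ⟨Ideal.span (l' '' L), ⟨_, ?_, rfl⟩, ?_⟩
    · rintro _ ⟨l, hl, rfl⟩
      exact hl' l hl
    · rw [extLast, Ideal.map_span, Set.image_image]
      congr 1
      refine (Set.image_id L).symm.trans (Set.image_congr fun l hl => ?_)
      conv_lhs => rw [id, hc l hl, h0 l hl]
      simp
  · push Not at h0
    obtain ⟨l₀, hl₀, h0⟩ := h0
    let ℓ : MvPolynomial (Fin m) k := -(C (c l₀)⁻¹ * l' l₀)
    have hℓ : ℓ.IsHomogeneous 1 := ((hl' l₀ hl₀).C_mul _).neg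
    have hlast : lastSub ℓ = C (c l₀)⁻¹ * l₀ := by
      have hcc : C (c l₀)⁻¹ * C (c l₀) = (1 : MvPolynomial (Fin (m + 1)) k) := by
        rw [← C_mul, inv_mul_cancel₀ h0, C_1]
      simp only [lastSub, ℓ, map_neg, map_mul, rename_C]
      linear_combination -C (c l₀)⁻¹ * hc l₀ hl₀ - X (Fin.last m) * hcc
    have hincl : ∀ l ∈ L, inclLast m k (l' l + C (c l) * ℓ) = l - C (c l) * lastSub ℓ := by
      intro l hl
      rw [map_add, map_mul, rename_C, lastSub]
      linear_combination -hc l hl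
    refine Or.inr ⟨Ideal.span ((fun l => l' l + C (c l) * ℓ) '' L), ℓ, ⟨_, ?_, rfl⟩, hℓ,
      le_antisymm ?_ ?_⟩
    · rintro _ ⟨l, hl, rfl⟩
      exact (hl' l hl).add (hℓ.C_mul _)
    · refine Ideal.span_le.2 fun l hl => ?_
      have h₁ : l = inclLast m k (l' l + C (c l) * ℓ) + C (c l) * lastSub ℓ := by
        rw [hincl l hl]
        ring
      rw [h₁]
      exact Ideal.add_mem _
        (Ideal.mem_sup_left (Ideal.mem_map_of_mem _
          (Ideal.subset_span (Set.mem_image_of_mem _ hl))))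
        (Ideal.mul_mem_left _ _ (Ideal.mem_sup_right (Ideal.mem_span_singleton_self _)))
    · have hmem : lastSub ℓ ∈ Ideal.span L := by
        rw [hlast]
        exact Ideal.mul_mem_left _ _ (Ideal.subset_span hl₀)
      rw [Submodule.add_eq_sup]
      refine sup_le ?_ ((Ideal.span_singleton_le_iff_mem _).2 hmem)
      rw [extLast, Ideal.map_span, Ideal.span_le]
      rintro _ ⟨_, ⟨l, hl, rfl⟩, rfl⟩
      exact (congrArg (· ∈ Ideal.span L) (hincl l hl)).mpr
        (Ideal.sub_mem _ (Ideal.subset_span hl) (Ideal.mul_mem_left _ _ hmem))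

end LinearForms

/-! ### Powers of the sum of the two ideals -/

section SumIdeal

variable {k : Type*} [Field k] {r s : ℕ}

theorem map_natAdd_extLast (J : Ideal (MvPolynomial (Fin s) k)) :
    (extLast J).map (rename (R := k) (Fin.natAdd r)) =
      extLast (m := r + s) (J.map (rename (R := k) (Fin.natAdd r))) := by
  rw [extLast, extLast, Ideal.map_mapₐ, Ideal.map_mapₐ]
  congr 1
  ext j
  simp [rename_X]

theorem map_castAdd_succ (I : Ideal (MvPolynomial (Fin r) k)) :
    I.map (rename (R := k) (Fin.castAdd (s + 1))) =
      extLast (m := r + s) (I.map (rename (R := k) (Fin.castAdd s))) := by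
  rw [extLast, Ideal.map_mapₐ]
  congr 1
  refine MvPolynomial.algHom_ext fun j => ?_
  rw [AlgHom.comp_apply, rename_X, rename_X, rename_X]
  rfl

theorem sumIdeal_extLast (I : Ideal (MvPolynomial (Fin r) k))
    (J : Ideal (MvPolynomial (Fin s) k)) :
    sumIdeal I (extLast J) = extLast (m := r + s) (sumIdeal I J) := by
  rw [sumIdeal, sumIdeal, map_natAdd_extLast, map_castAdd_succ, extLast, extLast, extLast,
    Submodule.add_eq_sup, Submodule.add_eq_sup, Ideal.map_sup]

theorem sumIdeal_extLast_add (I : Ideal (MvPolynomial (Fin r) k))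
    (J : Ideal (MvPolynomial (Fin s) k)) (ℓ : MvPolynomial (Fin s) k) :
    sumIdeal I (extLast J + Ideal.span {lastSub ℓ}) =
      extLast (m := r + s) (sumIdeal I J) +
        Ideal.span {lastSub (m := r + s) (rename (Fin.natAdd r) ℓ)} := by
  rw [← sumIdeal_extLast, sumIdeal, sumIdeal, Submodule.add_eq_sup, Submodule.add_eq_sup,
    Submodule.add_eq_sup, Submodule.add_eq_sup, Ideal.map_sup, Ideal.map_span,
    Set.image_singleton, sup_assoc]
  congr 4
  rw [lastSub, lastSub, map_sub, rename_X, rename_rename, rename_rename]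
  rfl

theorem isHomogeneousIdeal_sumIdeal {I : Ideal (MvPolynomial (Fin r) k)}
    {J : Ideal (MvPolynomial (Fin s) k)} (hI : IsHomogeneousIdeal I) (hJ : IsHomogeneousIdeal J) :
    IsHomogeneousIdeal (sumIdeal I J) :=
  (hI.map_rename _).add (hJ.map_rename _)

theorem extLast_eq_bot_iff {m : ℕ} {Q : Ideal (MvPolynomial (Fin m) k)} :
    extLast Q = ⊥ ↔ Q = ⊥ :=
  Ideal.map_eq_bot_iff_of_injective (rename_injective _ (Fin.castSucc_injective m))

theorem extLast_add_ne_bot {m : ℕ} (Q : Ideal (MvPolynomial (Fin m) k))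
    (ℓ : MvPolynomial (Fin m) k) : extLast Q + Ideal.span {lastSub ℓ} ≠ ⊥ := by
  intro h
  have hmem : lastSub ℓ ∈ extLast Q + Ideal.span {lastSub ℓ} :=
    Ideal.mem_sup_right (Ideal.mem_span_singleton_self _)
  rw [h, Ideal.mem_bot] at hmem
  have := expandLast_lastSub ℓ
  rw [hmem, map_zero] at this
  exact Polynomial.X_ne_zero this.symm

theorem biInf_add_natCast {ι : Type*} (T : Set ι) (f : ι → ℕ∞) (d : ℕ) :
    ⨅ a ∈ T, (f a + d) = (⨅ a ∈ T, f a) + d := by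
  refine le_antisymm ?_ ?_
  · rw [← tsub_le_iff_right]
    simp only [le_iInf_iff]
    intro a ha
    rw [tsub_le_iff_right]
    exact iInf₂_le a ha
  · simp only [le_iInf_iff]
    intro a ha
    gcongr
    exact iInf₂_le a ha

theorem biInf_biInf_Icc {α : Type*} [CompleteLattice α] (f : ℕ → α) (n : ℕ) :
    ⨅ a ∈ Finset.Icc 1 n, ⨅ b ∈ Finset.Icc 1 a, f b = ⨅ a ∈ Finset.Icc 1 n, f a := by
  refine le_antisymm (le_iInf₂ fun a ha => ?_) (le_iInf₂ fun a ha => le_iInf₂ fun b hb => ?_)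
  · exact (iInf₂_le a ha).trans (iInf₂_le a
      (Finset.mem_Icc.2 ⟨(Finset.mem_Icc.1 ha).1, le_rfl⟩))
  · exact iInf₂_le b (Finset.mem_Icc.2
      ⟨(Finset.mem_Icc.1 hb).1, (Finset.mem_Icc.1 hb).2.trans (Finset.mem_Icc.1 ha).2⟩)

/-- Depth and regularity of all the powers of `I + J`, for `J` generated by linear forms, with the
residue class ring of `J` of dimension `d`. Ideals `J = 0` are included, with a formula of their
own, since they occur in the induction on the number of variables. -/
theorem depthQuot_regQuot_sumIdeal_pow {I : Ideal (MvPolynomial (Fin r) k)}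
    (hI : IsHomogeneousIdeal I) : ∀ {s : ℕ} (J : Ideal (MvPolynomial (Fin s) k)),
    IsLinearIdeal J → ∃ d : ℕ, ringKrullDim (MvPolynomial (Fin s) k ⧸ J) = (d : ℕ∞) ∧
      (J = ⊥ → ∀ n : ℕ, depthQuot (sumIdeal I J ^ n) = depthQuot (I ^ n) + d ∧
        regQuot (sumIdeal I J ^ n) - (n : EReal) = regQuot (I ^ n) - (n : EReal)) ∧
      (J ≠ ⊥ → ∀ n : ℕ,
        depthQuot (sumIdeal I J ^ n) = (⨅ a ∈ Finset.Icc 1 n, depthQuot (I ^ a)) + d ∧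
        regQuot (sumIdeal I J ^ n) - (n : EReal) =
          ⨆ a ∈ Finset.Icc 1 n, (regQuot (I ^ a) - (a : EReal))) := by
  intro s
  induction s with
  | zero =>
    intro J hJ
    have hJ0 : J = ⊥ := by
      obtain ⟨L, hL, rfl⟩ := hJ
      rw [Ideal.span_eq_bot]
      intro l hl
      by_contra h
      exact one_ne_zero ((hL l hl).inj_right (isHomogeneous_of_isEmpty (Fin 0) k l) h)
    subst hJ0
    refine ⟨0, ?_, fun _ n => ?_, fun h => absurd rfl h⟩
    · rw [ringKrullDim_eq_of_ringEquiv (RingEquiv.quotientBot _),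
        ringKrullDim_eq_of_ringEquiv (isEmptyRingEquiv k (Fin 0)), ringKrullDim_eq_zero_of_field]
      rfl
    · have hsum : sumIdeal I (⊥ : Ideal (MvPolynomial (Fin 0) k)) = I := by
        rw [sumIdeal, Ideal.map_bot, Submodule.add_eq_sup, sup_bot_eq]
        have : (rename (R := k) (Fin.castAdd 0) :
            MvPolynomial (Fin r) k →ₐ[k] MvPolynomial (Fin (r + 0)) k) = AlgHom.id k _ := by
          ext j
          simp
        rw [this]
        exact Ideal.map_id I
      rw [hsum]
      simp
  | succ s ih =>
    intro J hJ
    rcases hJ.eq_extLast_or with ⟨J', hJ', rfl⟩ | ⟨J', ℓ, hJ', hℓ, rfl⟩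
    · obtain ⟨d, hdim, h0, h1⟩ := ih J' hJ'
      have hpow : ∀ n, sumIdeal I (extLast J') ^ n = extLast (m := r + s) (sumIdeal I J' ^ n) :=
        fun n => by rw [sumIdeal_extLast, extLast, extLast, Ideal.map_pow]
      have hhom := isHomogeneousIdeal_sumIdeal hI hJ'.isHomogeneousIdeal
      have hdep : ∀ n, depthQuot (sumIdeal I (extLast J') ^ n) =
          depthQuot (sumIdeal I J' ^ n) + 1 := fun n => by
        rw [hpow]
        exact depthQuot_extLast _ (hhom.pow n)
      have hreg : ∀ n, regQuot (sumIdeal I (extLast J') ^ n) =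
          regQuot (sumIdeal I J' ^ n) := fun n => by
        rw [hpow]
        exact regQuot_extLast _ (hhom.pow n)
      refine ⟨d + 1, ?_, fun h n => ?_, fun h n => ?_⟩
      · rw [ringKrullDim_extLast, hdim]
        rfl
      · obtain ⟨hd, hr⟩ := h0 (extLast_eq_bot_iff.1 h) n
        exact ⟨by rw [hdep, hd, add_assoc]; rfl, by rw [hreg, hr]⟩
      · obtain ⟨hd, hr⟩ := h1 (fun h' => h (extLast_eq_bot_iff.2 h')) n
        exact ⟨by rw [hdep, hd, add_assoc]; rfl, by rw [hreg, hr]⟩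
    · obtain ⟨d, hdim, h0, h1⟩ := ih J' hJ'
      have hhom := isHomogeneousIdeal_sumIdeal hI hJ'.isHomogeneousIdeal
      have hℓ' : (rename (R := k) (Fin.natAdd r) ℓ).IsHomogeneous 1 := hℓ.rename_isHomogeneous
      refine ⟨d, by rw [ringKrullDim_add_lastSub, hdim],
        fun h => absurd h (extLast_add_ne_bot J' ℓ), fun _ n => ?_⟩
      rw [sumIdeal_extLast_add]
      have hdep := depthQuot_add_lastSub_pow _ hhom hℓ' n
      have hreg := regQuot_add_lastSub_pow_sub _ hhom hℓ' n
      refine ⟨hdep.trans ?_, hreg.trans ?_⟩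
      · by_cases hJ0 : J' = ⊥
        · simp only [(h0 hJ0 _).1]
          exact biInf_add_natCast (Finset.Icc 1 n : Set ℕ) _ d
        · simp only [(h1 hJ0 _).1]
          exact (biInf_add_natCast (Finset.Icc 1 n : Set ℕ) _ d).trans
            (congrArg (· + (d : ℕ∞)) (biInf_biInf_Icc _ n))
      · by_cases hJ0 : J' = ⊥
        · simp only [(h0 hJ0 _).2]
        · simp only [(h1 hJ0 _).2]
          -- the suprema are infima in the dual order
          exact biInf_biInf_Icc (α := ERealᵒᵈ) _ n

end SumIdeal

end GradedLocalCohomology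

open GradedLocalCohomology in
theorem proposition2 {k : Type*} [Field k] (r s : ℕ)
    (I : Ideal (MvPolynomial (Fin r) k)) (J : Ideal (MvPolynomial (Fin s) k))
    (hI : IsHomogeneousIdeal I) (hI0 : I ≠ ⊥) (hI1 : I ≠ ⊤) (hJ0 : J ≠ ⊥)
    (hJ : ∃ L : Set (MvPolynomial (Fin s) k), (∀ l ∈ L, l.IsHomogeneous 1) ∧ J = Ideal.span L)
    (n : ℕ) (hn : 1 ≤ n) :
    ((depthQuot (sumIdeal I J ^ n) : ℕ∞) : WithBot ℕ∞) =
        ((⨅ i ∈ Finset.Icc 1 n, depthQuot (I ^ i) : ℕ∞) : WithBot ℕ∞) +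
          ringKrullDim (MvPolynomial (Fin s) k ⧸ J) ∧
      regQuot (sumIdeal I J ^ n) =
        (⨆ i ∈ Finset.Icc 1 n, (regQuot (I ^ i) - (i : EReal))) + (n : EReal) := by
  obtain ⟨d, hdim, -, h⟩ := depthQuot_regQuot_sumIdeal_pow hI J hJ
  obtain ⟨hdepth, hreg⟩ := h hJ0 n
  refine ⟨by rw [hdepth, hdim]; rfl, ?_⟩
  rw [← hreg, ← EReal.coe_natCast, EReal.sub_add_cancel]
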